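/- Let $M$ be a smooth finite-dimensional manifold, $g$ a semi-Riemannian metric on $M$ (of any signature) and $\theta\in C^\infty(M)$. The graded tangent bundle of $M$ is the vector bundle $\hat TM=TM\oplus\mathbb R$, whose sections are written $X+h\xi$ with $X$ a vector field and $h$ a function on $M$. It is a Lie algebroid with anchor $\rho(X+h\xi)=X$ and bracket $[X+h\xi,\,Y+k\xi]=[X,Y]+(X(k)-Y(h))\,\xi$. Let $\hat g=(g,\theta)$ be the graded metric on $\hat TM$, $$\langle X+h\xi,\;Y+k\xi\rangle=g(X,Y)+hk\,e^{2\theta},$$ and let $\hat\nabla$ be its Levi-Civita connection, determined by the Koszul formula $$2\langle\hat\nabla_{\hat X}\hat Y,\hat Z\rangle=\rho(\hat X)\langle\hat Y,\hat Z\rangle+\rho(\hat Y)\langle\hat Z,\hat X\rangle-\rho(\hat Z)\langle\hat X,\hat Y\rangle+\langle[\hat X,\hat Y],\hat Z\rangle-\langle[\hat Y,\hat Z],\hat X\rangle+\langle[\hat Z,\hat X],\hat Y\rangle .$$ Its curvature is $\hat R(\hat X,\hat Y)\hat Z=\hat\nabla_{\hat X}\hat\nabla_{\hat Y}\hat Z-\hat\nabla_{\hat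 Y}\hat\nabla_{\hat X}\hat Z-\hat\nabla_{[\hat X,\hat Y]}\hat Z$. Its Ricci curvature $\widehat{\mathrm{Ric}}(\hat X,\hat Y)$ is the $\hat g$-trace of $(\hat A,\hat B)\mapsto\langle\hat R(\hat X,\hat A)\hat B,\hat Y\rangle$, and its scalar curvature $\hat R$ is the $\hat g$-trace of $\widehat{\mathrm{Ric}}$. Let $\nabla$ and $R$ be the Levi-Civita connection and the scalar curvature of $g$, with the same conventions. Let $\alpha$ be the 1-form on $M$ for which $\alpha(X)$ is the $\xi$-coefficient of $\hat\nabla_\xi X$, for vector fields $X$ on $M$, and set $$\tilde T(X,Y)=(\nabla_X\alpha)(Y)+\alpha(X)\alpha(Y).$$ **Theorem.** At every point of $M$, $$\hat R=R-2\,\mathrm{tr}(\tilde T),$$ where $\mathrm{tr}$ is the trace with respect to $g$. Moreover $$\hat R=R-2\left(\Delta\theta+|\nabla\theta|^2\right),$$ where $\nabla\theta$ is the gradient of $\theta$ with respect to $g$, $|\nabla\theta|^2=g(\nabla\theta,\nabla\theta)$, and $\Delta\theta=\mathrm{tr}(\mathrm{Hes}(\theta))$ with $\mathrm{Hes}(\theta)(X,Y)=(\nabla_Xd\theta)(Y)$.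 -/

import Mathlib

open Bundle Module
open scoped Manifold ContDiff Bundle

noncomputable section

/-! ### Semi-Riemannian metrics on vector bundles -/

/-- A smooth semi-Riemannian metric on a real vector bundle `V` over `M`: a smooth family of
symmetric nondegenerate bilinear forms on the fibres (of any signature). -/
structure SemiRiemannianMetric {E : Type*} [NormedAddCommGroup E] [NormedSpace ℝ E]
    {M : Type*} [TopologicalSpace M] [ChartedSpace E M]
    (F : Type*) [NormedAddCommGroup F] [NormedSpace ℝ F]
    (V : M → Type*) [TopologicalSpace (TotalSpace F V)]
    [∀ x, AddCommGroup (V x)] [∀ x, Module ℝ (V x)] [∀ x, TopologicalSpace (V x)]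
    [FiberBundle F V] [VectorBundle ℝ F V] where
  /-- the bilinear form on each fibre -/
  inner (x : M) : V x →L[ℝ] V x →L[ℝ] ℝ
  symm (x : M) (v w : V x) : inner x v w = inner x w v
  nondegenerate (x : M) (v : V x) (hv : ∀ w, inner x v w = 0) : v = 0
  contMDiff : ContMDiff 𝓘(ℝ, E) (𝓘(ℝ, E).prod 𝓘(ℝ, F →L[ℝ] F →L[ℝ] ℝ)) ∞
    (fun x ↦ TotalSpace.mk' (F →L[ℝ] F →L[ℝ] ℝ) x (inner x))

/-! ### Levi-Civita connection and curvature on a bundle with anchor and bracket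

The constructions are made once, for a vector bundle `V` over `M` with an anchor
`ρ : V → TM` and a bracket `br` of sections, and are used below for exactly two Lie algebroids:
the tangent bundle and the graded tangent bundle. -/

namespace Algebroid

section

variable {E : Type*} [NormedAddCommGroup E] [NormedSpace ℝ E]
  {M : Type*} [TopologicalSpace M] [ChartedSpace E M]
  {F : Type*} [NormedAddCommGroup F] [NormedSpace ℝ F]
  {V : M → Type*} [TopologicalSpace (TotalSpace F V)]
  [∀ x, AddCommGroup (V x)] [∀ x, Module ℝ (V x)] [∀ x, TopologicalSpace (V x)]
  [FiberBundle F V] [VectorBundle ℝ F V]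

/-- The derivative `X(f) = ρ(X)(f)` of a function along a section. -/
def deriv (ρ : ∀ x, V x →L[ℝ] TangentSpace 𝓘(ℝ, E) x) (X : Π x, V x) (f : M → ℝ) (x : M) : ℝ :=
  mfderiv 𝓘(ℝ, E) 𝓘(ℝ, ℝ) f x (ρ x (X x))

/-- The function `⟨X, Y⟩`. -/
def pairing (g : SemiRiemannianMetric (E := E) F V) (X Y : Π x, V x) (x : M) : ℝ :=
  g.inner x (X x) (Y x)

/-- The right-hand side of the Koszul formula. -/
def koszul (ρ : ∀ x, V x →L[ℝ] TangentSpace 𝓘(ℝ, E) x)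
    (br : (Π x, V x) → (Π x, V x) → Π x, V x) (g : SemiRiemannianMetric (E := E) F V)
    (X Y Z : Π x, V x) (x : M) : ℝ :=
  deriv ρ X (pairing g Y Z) x + deriv ρ Y (pairing g Z X) x - deriv ρ Z (pairing g X Y) x
    + pairing g (br X Y) Z x - pairing g (br Y Z) X x + pairing g (br Z X) Y x

/-- The Levi-Civita connection: `∇_X Y` at `x` is the vector `v` determined by the Koszul formula
`2⟨v, Z⟩ = koszul X Y Z`, for all sections `Z` that are smooth at `x`. -/
def leviCivita (ρ : ∀ x, V x →L[ℝ] TangentSpace 𝓘(ℝ, E) x)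
    (br : (Π x, V x) → (Π x, V x) → Π x, V x) (g : SemiRiemannianMetric (E := E) F V)
    (X Y : Π x, V x) (x : M) : V x :=
  @Classical.epsilon (V x) ⟨0⟩ fun v ↦
    ∀ Z : Π y, V y,
      ContMDiffAt 𝓘(ℝ, E) (𝓘(ℝ, E).prod 𝓘(ℝ, F)) ∞ (fun y ↦ TotalSpace.mk' F y (Z y)) x →
        2 * g.inner x v (Z x) = koszul ρ br g X Y Z x

/-- The curvature `R(X, Y) Z = ∇_X ∇_Y Z - ∇_Y ∇_X Z - ∇_[X, Y] Z` of the Levi-Civita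
connection. -/
def curvature (ρ : ∀ x, V x →L[ℝ] TangentSpace 𝓘(ℝ, E) x)
    (br : (Π x, V x) → (Π x, V x) → Π x, V x) (g : SemiRiemannianMetric (E := E) F V)
    (X Y Z : Π x, V x) (x : M) : V x :=
  leviCivita ρ br g X (leviCivita ρ br g Y Z) x - leviCivita ρ br g Y (leviCivita ρ br g X Z) x
    - leviCivita ρ br g (br X Y) Z x

/-- The frame of `V` near `x₀` given by the trivialization of `V` at `x₀`. -/
def frame [FiniteDimensional ℝ F] (x₀ : M) (i : Fin (finrank ℝ F)) : Π x, V x :=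
  (trivializationAt F V x₀).localFrame (finBasis ℝ F) i

/-- The metric trace `g^{ij} B(E_i, E_j)` at `x` of a 2-covariant tensor, given by its action `B`
on pairs of sections; `(E_i)` is a smooth frame near `x` and `(g^{ij})` is the inverse of the matrix
`(⟨E_i, E_j⟩)`. -/
def trace [FiniteDimensional ℝ F] (g : SemiRiemannianMetric (E := E) F V)
    (B : (Π x, V x) → (Π x, V x) → M → ℝ) (x : M) : ℝ :=
  ∑ i, ∑ j, (Matrix.of fun k l ↦ pairing g (frame (F := F) x k) (frame (F := F) x l) x)⁻¹ i j
    * B (frame (F := F) x i) (frame (F := F) x j) x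

/-- The Ricci curvature `Ric(X, Y) = g^{ij} ⟨R(X, E_i) E_j, Y⟩`. -/
def ricci [FiniteDimensional ℝ F] (ρ : ∀ x, V x →L[ℝ] TangentSpace 𝓘(ℝ, E) x)
    (br : (Π x, V x) → (Π x, V x) → Π x, V x) (g : SemiRiemannianMetric (E := E) F V)
    (X Y : Π x, V x) (x : M) : ℝ :=
  trace g (fun A B ↦ pairing g (curvature ρ br g X A B) Y) x

/-- The scalar curvature, the metric trace of the Ricci curvature. -/
def scalar [FiniteDimensional ℝ F] (ρ : ∀ x, V x →L[ℝ] TangentSpace 𝓘(ℝ, E) x)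
    (br : (Π x, V x) → (Π x, V x) → Π x, V x) (g : SemiRiemannianMetric (E := E) F V)
    (x : M) : ℝ :=
  trace g (ricci ρ br g) x

end

end Algebroid

/-! ### Semi-Riemannian manifolds -/

namespace SemiRiemannian

section

variable {E : Type*} [NormedAddCommGroup E] [NormedSpace ℝ E]
  {M : Type*} [TopologicalSpace M] [ChartedSpace E M] [IsManifold 𝓘(ℝ, E) ∞ M]

/-- The anchor of `TM`, the identity. -/
def anchor (x : M) : TangentSpace 𝓘(ℝ, E) x →L[ℝ] TangentSpace 𝓘(ℝ, E) x :=
  ContinuousLinearMap.id ℝ _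

/-- The Levi-Civita connection of a semi-Riemannian metric on `M`. -/
def leviCivita (g : SemiRiemannianMetric (E := E) E (TangentSpace 𝓘(ℝ, E) : M → Type _))
    (X Y : Π x : M, TangentSpace 𝓘(ℝ, E) x) (x : M) : TangentSpace 𝓘(ℝ, E) x :=
  Algebroid.leviCivita (F := E) anchor (VectorField.mlieBracket 𝓘(ℝ, E)) g X Y x

/-- The scalar curvature of a semi-Riemannian metric on `M`. -/
def scalarCurvature [FiniteDimensional ℝ E]
    (g : SemiRiemannianMetric (E := E) E (TangentSpace 𝓘(ℝ, E) : M → Type _)) (x : M) : ℝ :=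
  Algebroid.scalar (F := E) anchor (VectorField.mlieBracket 𝓘(ℝ, E)) g x

/-- The 1-form `df`, as an operator on vector fields: `df(X) = X(f)`. -/
def differential (f : M → ℝ) (X : Π x : M, TangentSpace 𝓘(ℝ, E) x) (x : M) : ℝ :=
  mfderiv 𝓘(ℝ, E) 𝓘(ℝ, ℝ) f x (X x)

/-- The covariant derivative `(∇_X α)(Y) = X(α(Y)) - α(∇_X Y)` of a 1-form `α`, the 1-form being
given by its action on vector fields. -/
def covDerivForm (g : SemiRiemannianMetric (E := E) E (TangentSpace 𝓘(ℝ, E) : M → Type _))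
    (α : (Π x : M, TangentSpace 𝓘(ℝ, E) x) → M → ℝ)
    (X Y : Π x : M, TangentSpace 𝓘(ℝ, E) x) (x : M) : ℝ :=
  differential (α Y) X x - α (leviCivita g X Y) x

/-- The Hessian `Hes(f)(X, Y) = (∇_X df)(Y)`. -/
def hessian (g : SemiRiemannianMetric (E := E) E (TangentSpace 𝓘(ℝ, E) : M → Type _))
    (f : M → ℝ) (X Y : Π x : M, TangentSpace 𝓘(ℝ, E) x) : M → ℝ :=
  covDerivForm g (differential f) X Y

/-- The Laplacian `Δf = tr(Hes(f))`. -/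
def laplacian [FiniteDimensional ℝ E]
    (g : SemiRiemannianMetric (E := E) E (TangentSpace 𝓘(ℝ, E) : M → Type _))
    (f : M → ℝ) (x : M) : ℝ :=
  Algebroid.trace g (hessian g f) x

/-- The gradient of `f`, determined by `g(∇f, w) = df(w)`. -/
def gradient (g : SemiRiemannianMetric (E := E) E (TangentSpace 𝓘(ℝ, E) : M → Type _))
    (f : M → ℝ) (x : M) : TangentSpace 𝓘(ℝ, E) x :=
  @Classical.epsilon (TangentSpace 𝓘(ℝ, E) x) ⟨0⟩ fun v ↦
    ∀ w, g.inner x v w = mfderiv 𝓘(ℝ, E) 𝓘(ℝ, ℝ) f x w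

/-- `|∇f|² = g(∇f, ∇f)`. -/
def gradientNormSq (g : SemiRiemannianMetric (E := E) E (TangentSpace 𝓘(ℝ, E) : M → Type _))
    (f : M → ℝ) (x : M) : ℝ :=
  g.inner x (gradient g f x) (gradient g f x)

end

end SemiRiemannian

/-! ### The graded tangent bundle -/

/-- The fibre `T_xM ⊕ ℝ` of the graded tangent bundle, the direct sum of the tangent bundle and the
trivial line bundle; `(v, h)` stands for `v + hξ`. -/
abbrev GradedTangentSpace (E : Type*) [NormedAddCommGroup E] [NormedSpace ℝ E]
    {M : Type*} [TopologicalSpace M] [ChartedSpace E M] : M → Type _ :=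
  (TangentSpace 𝓘(ℝ, E) : M → Type _) ×ᵇ (Bundle.Trivial M ℝ)

namespace Graded

section

variable {E : Type*} [NormedAddCommGroup E] [NormedSpace ℝ E]
  {M : Type*} [TopologicalSpace M] [ChartedSpace E M]

/-- An ordinary vector field as an even section of the graded tangent bundle. -/
def even (X : Π x : M, TangentSpace 𝓘(ℝ, E) x) (x : M) : GradedTangentSpace E x := (X x, 0)

/-- The odd section `ξ`. -/
def xi (x : M) : GradedTangentSpace E x := (0, 1)

/-- The anchor `ρ(v + hξ) = v`. -/
def anchor (x : M) : GradedTangentSpace E x →L[ℝ] TangentSpace 𝓘(ℝ, E) x :=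
  ContinuousLinearMap.fst ℝ (TangentSpace 𝓘(ℝ, E) x) ℝ

/-- The bracket `[X + hξ, Y + kξ] = [X, Y] + (X(k) - Y(h))ξ`. -/
def bracket (X Y : Π x : M, GradedTangentSpace E x) (x : M) : GradedTangentSpace E x :=
  (VectorField.mlieBracket 𝓘(ℝ, E) (fun y ↦ (X y).1) (fun y ↦ (Y y).1) x,
    Algebroid.deriv anchor X (fun y ↦ (Y y).2) x - Algebroid.deriv anchor Y (fun y ↦ (X y).2) x)

variable [IsManifold 𝓘(ℝ, E) ∞ M]

/-- The bilinear form `⟨v + hξ, w + kξ⟩ = g(v, w) + h k e^{2θ}` on the graded tangent space. -/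
def form (g : SemiRiemannianMetric (E := E) E (TangentSpace 𝓘(ℝ, E) : M → Type _))
    (θ : C^∞⟮𝓘(ℝ, E), M; ℝ⟯) (x : M) :
    GradedTangentSpace E x →L[ℝ] GradedTangentSpace E x →L[ℝ] ℝ :=
  (ContinuousLinearMap.precomp ℝ (ContinuousLinearMap.fst ℝ (TangentSpace 𝓘(ℝ, E) x) ℝ)) ∘L
      g.inner x ∘L ContinuousLinearMap.fst ℝ (TangentSpace 𝓘(ℝ, E) x) ℝ
    + Real.exp (2 * θ x) • (ContinuousLinearMap.snd ℝ (TangentSpace 𝓘(ℝ, E) x) ℝ).smulRight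
        (ContinuousLinearMap.snd ℝ (TangentSpace 𝓘(ℝ, E) x) ℝ)

theorem form_apply (g : SemiRiemannianMetric (E := E) E (TangentSpace 𝓘(ℝ, E) : M → Type _))
    (θ : C^∞⟮𝓘(ℝ, E), M; ℝ⟯) (x : M) (v w : GradedTangentSpace E x) :
    form g θ x v w = g.inner x v.1 w.1 + Real.exp (2 * θ x) * (v.2 * w.2) := rfl

theorem contMDiff_form (g : SemiRiemannianMetric (E := E) E (TangentSpace 𝓘(ℝ, E) : M → Type _))
    (θ : C^∞⟮𝓘(ℝ, E), M; ℝ⟯) :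
    ContMDiff 𝓘(ℝ, E) (𝓘(ℝ, E).prod 𝓘(ℝ, (E × ℝ) →L[ℝ] (E × ℝ) →L[ℝ] ℝ)) ∞
      (fun x ↦ TotalSpace.mk' ((E × ℝ) →L[ℝ] (E × ℝ) →L[ℝ] ℝ) x (form g θ x)) := by
  intro x₀
  have hg := ((contMDiffAt_hom_bundle _).1 (g.contMDiff x₀)).2
  refine (contMDiffAt_hom_bundle _).2 ⟨contMDiffAt_id, ?_⟩
  have hP := hg.clm_comp (contMDiffAt_const (c := ContinuousLinearMap.fst ℝ E ℝ))
  have hQ := (contMDiffAt_const (c := (ContinuousLinearMap.compL ℝ (E × ℝ) E ℝ).flip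
    (ContinuousLinearMap.fst ℝ E ℝ))).clm_comp hP
  have hθ : ContMDiffAt 𝓘(ℝ, E) 𝓘(ℝ, ℝ) ∞ (fun x ↦ Real.exp (2 * θ x)) x₀ :=
    (Real.contDiff_exp.contMDiff.comp
      ((contDiff_const.mul contDiff_id).contMDiff.comp θ.contMDiff)).contMDiffAt
  have hS := hθ.smul (contMDiffAt_const (I' := 𝓘(ℝ, (E × ℝ) →L[ℝ] (E × ℝ) →L[ℝ] ℝ)) (c := (ContinuousLinearMap.snd ℝ E ℝ).smulRight
    (ContinuousLinearMap.snd ℝ E ℝ)))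
  refine (hQ.add hS).congr_of_eventuallyEq ?_
  have hb : (trivializationAt E (TangentSpace 𝓘(ℝ, E) : M → Type _) x₀).baseSet ∈ nhds x₀ :=
    (trivializationAt E (TangentSpace 𝓘(ℝ, E) : M → Type _) x₀).open_baseSet.mem_nhds
      (FiberBundle.mem_baseSet_trivializationAt' x₀)
  filter_upwards [hb] with x hx
  have hx' : x ∈ (trivializationAt (E × ℝ) (GradedTangentSpace E : M → Type _) x₀).baseSet :=
    ⟨hx, Set.mem_univ x⟩
  refine ContinuousLinearMap.ext fun v ↦ ContinuousLinearMap.ext fun w ↦ ?_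
  refine (inCoordinates_apply_eq₂ hx' hx' (Set.mem_univ x)).trans ?_
  refine Eq.trans ?_ (congrArg (· + Real.exp (2 * θ x) * (v.2 * w.2))
    (inCoordinates_apply_eq₂ (v := v.1) (w := w.1) hx hx (Set.mem_univ x)).symm)
  have hsymm (u : E × ℝ) :
      (trivializationAt (E × ℝ) (GradedTangentSpace E : M → Type _) x₀).symm x u =
        ((trivializationAt E (TangentSpace 𝓘(ℝ, E) : M → Type _) x₀).symm x u.1, u.2) := by
    have h := ((trivializationAt (E × ℝ) (GradedTangentSpace E : M → Type _) x₀).mk_symm hx' u).trans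
      (Bundle.Trivialization.prod_symm_apply
        (e₁ := trivializationAt E (TangentSpace 𝓘(ℝ, E) : M → Type _) x₀)
        (e₂ := Bundle.Trivial.trivialization M ℝ) x u.1 u.2)
    rw [Bundle.Trivial.trivialization_symm_apply] at h
    exact eq_of_heq (TotalSpace.mk.inj h).2
  have hlin (r : ℝ) : (trivializationAt ℝ (Bundle.Trivial M ℝ) x₀).linearMapAt ℝ x r = r := by
    exact congrArg (fun f : ℝ →ₗ[ℝ] ℝ ↦ f r)
      (Bundle.Trivial.linearMapAt_trivialization ℝ M ℝ x)
  rw [hsymm, hsymm, form_apply]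
  exact (hlin _).trans (congrArg (· + Real.exp (2 * θ x) * (v.2 * w.2)) (hlin _).symm)

/-- The graded metric `ĝ = (g, θ)` on the graded tangent bundle. -/
def metric (g : SemiRiemannianMetric (E := E) E (TangentSpace 𝓘(ℝ, E) : M → Type _))
    (θ : C^∞⟮𝓘(ℝ, E), M; ℝ⟯) :
    SemiRiemannianMetric (E := E) (M := M) (E × ℝ) (GradedTangentSpace E) where
  inner := form g θ
  symm x v w := by rw [form_apply, form_apply, g.symm x v.1 w.1, mul_comm v.2 w.2]
  nondegenerate x v hv := by
    refine Prod.ext (g.nondegenerate x v.1 fun w ↦ ?_) ?_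
    · simpa [form_apply] using hv (w, 0)
    · simpa [form_apply] using hv (0, 1)
  contMDiff := contMDiff_form g θ

/-- The Levi-Civita connection of the graded metric `(g, θ)`. -/
def leviCivita (g : SemiRiemannianMetric (E := E) E (TangentSpace 𝓘(ℝ, E) : M → Type _))
    (θ : C^∞⟮𝓘(ℝ, E), M; ℝ⟯) (X Y : Π x : M, GradedTangentSpace E x) (x : M) :
    GradedTangentSpace E x :=
  Algebroid.leviCivita (F := E × ℝ) anchor bracket (metric g θ) X Y x

/-- The scalar curvature of the graded metric `(g, θ)`. -/
def scalarCurvature [FiniteDimensional ℝ E]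
    (g : SemiRiemannianMetric (E := E) E (TangentSpace 𝓘(ℝ, E) : M → Type _))
    (θ : C^∞⟮𝓘(ℝ, E), M; ℝ⟯) (x : M) : ℝ :=
  Algebroid.scalar (F := E × ℝ) anchor bracket (metric g θ) x

/-- The 1-form `α` of the Levi-Civita connection of `(g, θ)`: `α(X)` is the coefficient of `ξ` in
the graded covariant derivative of `X` along `ξ`. -/
def alpha (g : SemiRiemannianMetric (E := E) E (TangentSpace 𝓘(ℝ, E) : M → Type _))
    (θ : C^∞⟮𝓘(ℝ, E), M; ℝ⟯) (X : Π x : M, TangentSpace 𝓘(ℝ, E) x) (x : M) : ℝ :=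
  (leviCivita g θ xi (even X) x).2

/-- The tensor `T̃(X, Y) = (∇_X α)(Y) + α(X) α(Y)`. -/
def tensorT (g : SemiRiemannianMetric (E := E) E (TangentSpace 𝓘(ℝ, E) : M → Type _))
    (θ : C^∞⟮𝓘(ℝ, E), M; ℝ⟯) (X Y : Π x : M, TangentSpace 𝓘(ℝ, E) x) (x : M) : ℝ :=
  SemiRiemannian.covDerivForm g (alpha g θ) X Y x + alpha g θ X x * alpha g θ Y x

end

end Graded

end

/-!
The connection `∇̂` of the graded metric is computed explicitly from the Koszul formula
(`Graded.leviCivita_eq`):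

  `∇̂_{X + hξ}(Y + kξ) = ∇_X Y - hk e^{2θ} ∇θ + (X(k) + k X(θ) + h Y(θ)) ξ`.

In particular `α = dθ` (`Graded.alpha_eq`), hence `T̃ = Hes(θ) + dθ ⊗ dθ`, and the two formulas
for the scalar curvature agree because the trace of `dθ ⊗ dθ` is `|∇θ|²`
(`SemiRiemannian.sum_inv_gram_mul_mfderiv_mul_mfderiv`). Applying `∇̂` twice expresses the
curvature of the graded metric by the curvature of `g` and by `T̃` (`Graded.inner_curvature_eq`):
apart from `⟨R(u, v)w, z⟩`, every term takes the `ξ`-coefficients of exactly two of the four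
arguments, inserts the tangent parts of the other two into `T̃`, and carries the factor `e^{2θ}`.
In a basis of `TM ⊕ ℝ` that consists of a basis of `TM` and of `ξ`, the inverse Gram matrix is
block diagonal with entry `e^{-2θ}` at `ξ`. So the double trace of the curvature consists of the
scalar curvature of `g`, of `-tr T̃` from `⟨R̂(u, ξ)ξ, v⟩` and of `-tr T̃` from `⟨R̂(ξ, u)v, ξ⟩`
(`Graded.scalarCurvature_eq`).

Two points need care. The curvature is defined on sections, while a change of basis requires a
quadrilinear form on one fibre. Such a form is obtained by evaluating the curvature on the local
extensions of vectors that are constant in a trivialization (`Algebroid.localExtension`); they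
depend linearly on the vector, which makes additivity in sections sufficient. And the Levi-Civita
connection is defined by a choice, so the existence of the chosen vector is proved from the
tensoriality of the Koszul formula (`SemiRiemannian.two_mul_inner_leviCivita`), and the smoothness
of `∇_X Y`, needed for second derivatives, from the smoothness of the inverse Gram matrix
(`Algebroid.contMDiffAt_of_pairing`).
-/

noncomputable section

open Filter Topology FiberBundle

/-! ### Metric traces of bilinear forms -/

section MetricTrace

variable {W : Type*} [AddCommGroup W] [Module ℝ W] {ι κ : Type*} [Fintype ι] [DecidableEq ι]
  [Fintype κ] [DecidableEq κ]

/-- The Gram matrix of a family of vectors with respect to a bilinear form. -/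
def gram (G : LinearMap.BilinForm ℝ W) (b : ι → W) : Matrix ι ι ℝ := .of fun i j ↦ G (b i) (b j)

theorem isUnit_det_gram {G : LinearMap.BilinForm ℝ W} (hG : ∀ v, (∀ w, G v w = 0) → v = 0)
    (b : Basis ι ℝ W) : IsUnit (gram G b).det := by
  rw [isUnit_iff_ne_zero]
  intro h0
  obtain ⟨v, hv, hv0⟩ := Matrix.exists_vecMul_eq_zero_iff.2 h0
  refine hv ?_
  have h : ∑ i, v i • b i = 0 := hG _ fun w ↦ by
    rw [← b.sum_repr w, map_sum]
    refine Finset.sum_eq_zero fun j _ ↦ ?_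
    have := congrFun hv0 j
    simp only [gram, Matrix.vecMul, dotProduct, Matrix.of_apply, Pi.zero_apply] at this
    simp [this]
  exact funext fun i ↦ Fintype.linearIndependent_iff.1 b.linearIndependent v h i

/-- The metric trace of `B` is the trace of the endomorphism `A` that represents `B`. In particular,
it does not depend on the basis. -/
theorem sum_inv_gram_mul_eq_trace {G B : LinearMap.BilinForm ℝ W} (hs : ∀ v w, G v w = G w v)
    (hG : ∀ v, (∀ w, G v w = 0) → v = 0) (b : Basis ι ℝ W) (A : W →ₗ[ℝ] W)
    (hA : ∀ u v, G (A u) v = B u v) :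
    ∑ i, ∑ j, (gram G b)⁻¹ i j * B (b i) (b j) = LinearMap.trace ℝ W A := by
  have hGA : gram G b * LinearMap.toMatrix b b A = (gram B b).transpose := by
    ext i j
    simp only [gram, Matrix.mul_apply, Matrix.of_apply, Matrix.transpose_apply]
    rw [← hA, hs]
    conv_rhs => rw [← b.sum_repr (A (b j))]
    simp only [map_sum, map_smul, smul_eq_mul, LinearMap.toMatrix_apply, mul_comm]
  rw [LinearMap.trace_eq_matrix_trace ℝ b, ← Matrix.nonsing_inv_mul_cancel_left (gram G b)
    (LinearMap.toMatrix b b A) (isUnit_det_gram hG b), hGA]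
  simp [Matrix.trace, Matrix.mul_apply, gram]

/-- Bilinear forms are represented by endomorphisms. -/
theorem exists_endomorphism [FiniteDimensional ℝ W] {G : LinearMap.BilinForm ℝ W}
    (hG : ∀ v, (∀ w, G v w = 0) → v = 0) (B : LinearMap.BilinForm ℝ W) :
    ∃ A : W →ₗ[ℝ] W, ∀ u v, G (A u) v = B u v := by
  have hinj : Function.Injective (G : W →ₗ[ℝ] Module.Dual ℝ W) :=
    (injective_iff_map_eq_zero _).2 fun v hv ↦ hG v fun w ↦ by simp [hv]
  let e := LinearEquiv.ofInjectiveOfFinrankEq G hinj Subspace.dual_finrank_eq.symm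
  exact ⟨e.symm.toLinearMap ∘ₗ B, fun u v ↦
    DFunLike.congr_fun (e.apply_symm_apply (B u)) v⟩

theorem sum_inv_gram_mul_eq {G : LinearMap.BilinForm ℝ W} (hs : ∀ v w, G v w = G w v)
    (hG : ∀ v, (∀ w, G v w = 0) → v = 0) (b : Basis ι ℝ W) (c : Basis κ ℝ W)
    {B : W → W → ℝ} (hB : IsBilinearMap ℝ B) :
    ∑ i, ∑ j, (gram G b)⁻¹ i j * B (b i) (b j) = ∑ i, ∑ j, (gram G c)⁻¹ i j * B (c i) (c j) := by
  have := Module.Finite.of_basis b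
  obtain ⟨A, hA⟩ := exists_endomorphism hG hB.toLinearMap
  exact (sum_inv_gram_mul_eq_trace hs hG b A hA).trans
    (sum_inv_gram_mul_eq_trace hs hG c A hA).symm

/-- The double metric trace of a quadrilinear form does not depend on the basis. -/
theorem sum_inv_gram_mul_sum_eq {G : LinearMap.BilinForm ℝ W} (hs : ∀ v w, G v w = G w v)
    (hG : ∀ v, (∀ w, G v w = 0) → v = 0) (b : Basis ι ℝ W) (c : Basis κ ℝ W)
    {Φ : W → W → W → W → ℝ} (h₁ : ∀ v w, IsBilinearMap ℝ fun a d ↦ Φ a v w d)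
    (h₂ : ∀ a d, IsBilinearMap ℝ fun v w ↦ Φ a v w d) :
    ∑ i, ∑ j, (gram G b)⁻¹ i j * ∑ k, ∑ l, (gram G b)⁻¹ k l * Φ (b i) (b k) (b l) (b j) =
      ∑ i, ∑ j, (gram G c)⁻¹ i j * ∑ k, ∑ l, (gram G c)⁻¹ k l * Φ (c i) (c k) (c l) (c j) := by
  have hB : IsBilinearMap ℝ fun a d ↦
      ∑ k, ∑ l, (gram G c)⁻¹ k l * Φ a (c k) (c l) d :=
    { add_left := fun u v w ↦ by simp [(h₁ _ _).add_left, mul_add, Finset.sum_add_distrib]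
      add_right := fun u v w ↦ by simp [(h₁ _ _).add_right, mul_add, Finset.sum_add_distrib]
      smul_left := fun r v w ↦ by
        simp [(h₁ _ _).smul_left, Finset.mul_sum, mul_left_comm]
      smul_right := fun r v w ↦ by
        simp [(h₁ _ _).smul_right, Finset.mul_sum, mul_left_comm] }
  refine Eq.trans ?_ (sum_inv_gram_mul_eq hs hG b c hB)
  exact Finset.sum_congr rfl fun i _ ↦ Finset.sum_congr rfl fun j _ ↦ by
    rw [sum_inv_gram_mul_eq hs hG b c (h₂ _ _)]

end MetricTrace

namespace Algebroid

section

variable {E : Type*} [NormedAddCommGroup E] [NormedSpace ℝ E]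
  {M : Type*} [TopologicalSpace M] [ChartedSpace E M]
  {F : Type*} [NormedAddCommGroup F] [NormedSpace ℝ F]
  {V : M → Type*} [TopologicalSpace (TotalSpace F V)]
  [∀ x, AddCommGroup (V x)] [∀ x, Module ℝ (V x)] [∀ x, TopologicalSpace (V x)]
  [FiberBundle F V] [VectorBundle ℝ F V]
  {ρ : ∀ x, V x →L[ℝ] TangentSpace 𝓘(ℝ, E) x}
  {br : (Π x, V x) → (Π x, V x) → Π x, V x}
  {g : SemiRiemannianMetric (E := E) F V} {X X' Y Y' Z : Π x, V x} {f h : M → ℝ} {x : M}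

/-! ### Derivatives along sections and products of sections -/

theorem deriv_eq_mvfderiv : deriv ρ X f x = mvfderiv 𝓘(ℝ, E) f x (ρ x (X x)) := rfl

theorem deriv_add (hf : MDiffAt f x) (hh : MDiffAt h x) :
    deriv ρ X (f + h) x = deriv ρ X f x + deriv ρ X h x :=
  DFunLike.congr_fun (mvfderiv_add hf hh) (ρ x (X x))

theorem deriv_mul (hf : MDiffAt f x) (hh : MDiffAt h x) :
    deriv ρ X (f * h) x = f x * deriv ρ X h x + deriv ρ X f x * h x := by
  simp only [deriv_eq_mvfderiv, mvfderiv_mul hf hh]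
  simp [mul_comm]

theorem deriv_const (c : ℝ) : deriv ρ X (fun _ ↦ c) x = 0 := by
  simp [deriv_eq_mvfderiv, mvfderiv, mfderiv_const]

theorem deriv_congr (hX : X x = X' x) (hf : f =ᶠ[𝓝 x] h) : deriv ρ X f x = deriv ρ X' h x := by
  rw [deriv, deriv, hX]
  exact congrArg (fun L : TangentSpace 𝓘(ℝ, E) x →L[ℝ] ℝ ↦ L (ρ x (X' x))) hf.mfderiv_eq

theorem deriv_add_left : deriv ρ (X + X') f x = deriv ρ X f x + deriv ρ X' f x := by
  simp [deriv_eq_mvfderiv]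

theorem deriv_smul_left : deriv ρ (f • X) h x = f x * deriv ρ X h x := by
  simp [deriv_eq_mvfderiv]

theorem pairing_add_left : pairing g (X + X') Y = pairing g X Y + pairing g X' Y := by
  funext y; simp [pairing]

theorem pairing_add_right : pairing g X (Y + Y') = pairing g X Y + pairing g X Y' := by
  funext y; simp [pairing]

theorem pairing_smul_left : pairing g (f • X) Y = f * pairing g X Y := by
  funext y; simp [pairing]

theorem pairing_smul_right : pairing g X (f • Y) = f * pairing g X Y := by
  funext y; simp [pairing]

theorem contMDiffAt_pairing (hX : CMDiffAt ∞ (T% X) x) (hY : CMDiffAt ∞ (T% Y) x) :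
    CMDiffAt ∞ (pairing g X Y) x := by
  have := ContMDiffAt.clm_bundle_apply₂ (F₁ := F) (F₂ := F) (F₃ := ℝ) (E₃ := Bundle.Trivial M ℝ)
    (b := id) (g.contMDiff x) hX hY
  simpa using! (contMDiffAt_section _).1 this

theorem mdifferentiableAt_pairing (hX : MDiffAt (T% X) x) (hY : MDiffAt (T% Y) x) :
    MDiffAt (pairing g X Y) x := by
  have := MDifferentiableAt.clm_bundle_apply₂ (F₁ := F) (F₂ := F) (F₃ := ℝ)
    (E₃ := Bundle.Trivial M ℝ)
    (b := id) ((g.contMDiff x).mdifferentiableAt (by simp)) hX hY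
  simpa using! (mdifferentiableAt_section _ _).1 this

/-- The metric on a fibre, as a bilinear form. -/
def fiberForm (g : SemiRiemannianMetric (E := E) F V) (x : M) : LinearMap.BilinForm ℝ (V x) :=
  LinearMap.mk₂ ℝ (fun v w ↦ g.inner x v w) (by simp) (by simp) (by simp) (by simp)

theorem fiberForm_apply (v w : V x) : fiberForm g x v w = g.inner x v w := rfl

/-- For a bracket that depends only on germs, the Koszul expression depends only on germs. -/
theorem koszul_congr (hbr : ∀ {A A' B B' : Π x, V x}, (∀ᶠ y in 𝓝 x, A y = A' y) →
      (∀ᶠ y in 𝓝 x, B y = B' y) → br A B x = br A' B' x)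
    (hX : ∀ᶠ y in 𝓝 x, X y = X' y) (hY : ∀ᶠ y in 𝓝 x, Y y = Y' y) :
    koszul ρ br g X Y Z x = koszul ρ br g X' Y' Z x := by
  have hZ : ∀ᶠ y in 𝓝 x, Z y = Z y := .of_forall fun _ ↦ rfl
  have h₁ : pairing g Y Z =ᶠ[𝓝 x] pairing g Y' Z := hY.mono fun y hy ↦ by simp [pairing, hy]
  have h₂ : pairing g Z X =ᶠ[𝓝 x] pairing g Z X' := hX.mono fun y hy ↦ by simp [pairing, hy]
  have h₃ : pairing g X Y =ᶠ[𝓝 x] pairing g X' Y' :=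
    (hX.and hY).mono fun y hy ↦ by simp [pairing, hy.1, hy.2]
  simp only [koszul, deriv_congr hX.self_of_nhds h₁, deriv_congr hY.self_of_nhds h₂,
    deriv_congr rfl h₃, pairing, hbr hX hY, hbr hY hZ, hbr hZ hX, hX.self_of_nhds,
    hY.self_of_nhds]

theorem leviCivita_congr (hbr : ∀ {A A' B B' : Π x, V x}, (∀ᶠ y in 𝓝 x, A y = A' y) →
      (∀ᶠ y in 𝓝 x, B y = B' y) → br A B x = br A' B' x)
    (hX : ∀ᶠ y in 𝓝 x, X y = X' y) (hY : ∀ᶠ y in 𝓝 x, Y y = Y' y) :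
    leviCivita ρ br g X Y x = leviCivita ρ br g X' Y' x := by
  simp only [leviCivita, koszul_congr hbr hX hY]

theorem curvature_congr (hbr : ∀ x, ∀ {A A' B B' : Π x, V x}, (∀ᶠ y in 𝓝 x, A y = A' y) →
      (∀ᶠ y in 𝓝 x, B y = B' y) → br A B x = br A' B' x) {Z' : Π x, V x}
    (hX : ∀ᶠ y in 𝓝 x, X y = X' y) (hY : ∀ᶠ y in 𝓝 x, Y y = Y' y)
    (hZ : ∀ᶠ y in 𝓝 x, Z y = Z' y) :
    curvature ρ br g X Y Z x = curvature ρ br g X' Y' Z' x := by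
  have hXZ : ∀ᶠ y in 𝓝 x, leviCivita ρ br g X Z y = leviCivita ρ br g X' Z' y := by
    filter_upwards [hX.eventually_nhds, hZ.eventually_nhds] with y h₁ h₂
    exact leviCivita_congr (hbr y) h₁ h₂
  have hYZ : ∀ᶠ y in 𝓝 x, leviCivita ρ br g Y Z y = leviCivita ρ br g Y' Z' y := by
    filter_upwards [hY.eventually_nhds, hZ.eventually_nhds] with y h₁ h₂
    exact leviCivita_congr (hbr y) h₁ h₂
  have hXY : ∀ᶠ y in 𝓝 x, br X Y y = br X' Y' y := by
    filter_upwards [hX.eventually_nhds, hY.eventually_nhds] with y h₁ h₂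
    exact hbr y h₁ h₂
  simp only [curvature, leviCivita_congr (hbr x) hX hYZ, leviCivita_congr (hbr x) hY hXZ,
    leviCivita_congr (hbr x) hXY hZ]

/-! ### Local extensions of vectors and traces -/

variable (F) in
/-- The extension of a vector at `x` to a section near `x` that is constant in the trivialization
at `x`. Unlike `FiberBundle.extend`, it vanishes outside the domain of the trivialization, so that
it is linear in the vector. -/
def localExtension (v : V x) (y : M) : V y :=
  (trivializationAt F V x).symmL ℝ y ((trivializationAt F V x).continuousLinearMapAt ℝ x v)

theorem localExtension_add (v w : V x) :
    localExtension F (v + w) = localExtension F v + localExtension F w := by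
  funext y
  simp [localExtension]

theorem localExtension_smul (c : ℝ) (v : V x) :
    localExtension F (c • v) = c • localExtension F v := by
  funext y
  simp [localExtension]

@[simp]
theorem localExtension_self (v : V x) : localExtension F v x = v := by
  simp [localExtension, mem_baseSet_trivializationAt F V x]

theorem localExtension_eventuallyEq_extend (v : V x) :
    ∀ᶠ y in 𝓝 x, localExtension F v y = extend F v y := by
  have hx := mem_baseSet_trivializationAt F V x
  filter_upwards [(trivializationAt F V x).open_baseSet.mem_nhds hx] with y hy
  simp [localExtension, extend, hy, hx, Trivialization.symmL_apply]

theorem contMDiffAt_localExtension (v : V x) : CMDiffAt ∞ (T% (localExtension F v)) x :=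
  (contMDiffAt_extend 𝓘(ℝ, E) F v).congr_of_eventuallyEq
    ((localExtension_eventuallyEq_extend (F := F) v).mono fun y hy ↦ by simp [hy])

theorem frame_eq_localExtension [FiniteDimensional ℝ F] (i : Fin (finrank ℝ F)) :
    frame (F := F) x i = localExtension F (frame (F := F) (V := V) x i x) := by
  funext y
  have hx := mem_baseSet_trivializationAt F V x
  by_cases hy : y ∈ (trivializationAt F V x).baseSet
  · simp [frame, localExtension, hy, hx, Trivialization.basisAt, Trivialization.symmL_apply]
  · simp [frame, localExtension, Trivialization.localFrame_apply_of_notMem, hy, hx]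

/-- The frame at the base point, as a basis of the fibre. -/
def frameBasis [FiniteDimensional ℝ F] (V : M → Type*) [TopologicalSpace (TotalSpace F V)]
    [∀ x, AddCommGroup (V x)] [∀ x, Module ℝ (V x)] [∀ x, TopologicalSpace (V x)]
    [FiberBundle F V] [VectorBundle ℝ F V] (x : M) : Basis (Fin (finrank ℝ F)) ℝ (V x) :=
  (trivializationAt F V x).basisAt (finBasis ℝ F) (mem_baseSet_trivializationAt F V x)

theorem frame_self [FiniteDimensional ℝ F] (i : Fin (finrank ℝ F)) :
    frame (F := F) (V := V) x i x = frameBasis (F := F) V x i := by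
  simp [frame, frameBasis, mem_baseSet_trivializationAt F V x]

/-- A metric trace is the trace, in the basis `frameBasis`, of the action of the tensor on the
canonical local extensions of vectors at `x`. -/
theorem trace_eq_sum [FiniteDimensional ℝ F] (B : (Π x, V x) → (Π x, V x) → M → ℝ) :
    trace (F := F) g B x = ∑ i, ∑ j, (gram (fiberForm g x) (frameBasis (F := F) V x))⁻¹ i j *
      B (localExtension F (frameBasis (F := F) V x i))
        (localExtension F (frameBasis (F := F) V x j)) x := by
  simp only [trace, gram, fiberForm_apply, pairing, ← frame_self, ← frame_eq_localExtension]

theorem scalar_eq_sum [FiniteDimensional ℝ F] :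
    scalar ρ br g x = ∑ i, ∑ j, (gram (fiberForm g x) (frameBasis (F := F) V x))⁻¹ i j *
      ∑ k, ∑ l, (gram (fiberForm g x) (frameBasis (F := F) V x))⁻¹ k l *
        g.inner x (curvature ρ br g (localExtension F (frameBasis (F := F) V x i))
          (localExtension F (frameBasis (F := F) V x k))
          (localExtension F (frameBasis (F := F) V x l)) x)
          (frameBasis (F := F) V x j) := by
  simp only [scalar, trace_eq_sum, ricci, pairing, localExtension_self]

/-! ### Sections determined by their products with other sections -/

theorem inner_ext {v w : V x} (h : ∀ Z : Π y, V y, CMDiffAt ∞ (T% Z) x →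
    g.inner x v (Z x) = g.inner x w (Z x)) : v = w := by
  refine sub_eq_zero.1 (g.nondegenerate x _ fun u ↦ ?_)
  have := h (localExtension F u) (contMDiffAt_localExtension _)
  simp_all [map_sub]

/-- The vector determined by the Koszul formula is unique. Its existence has to be shown separately
for each of the two bundles. -/
theorem leviCivita_eq {v : V x} (h : ∀ Z : Π y, V y, CMDiffAt ∞ (T% Z) x →
    2 * g.inner x v (Z x) = koszul ρ br g X Y Z x) : leviCivita ρ br g X Y x = v := by
  have hs := @Classical.epsilon_spec _ (fun v : V x ↦ ∀ Z : Π y, V y,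
      CMDiffAt ∞ (T% Z) x → 2 * g.inner x v (Z x) = koszul ρ br g X Y Z x) ⟨v, h⟩
  refine inner_ext (g := g) fun Z hZ ↦ ?_
  exact mul_left_cancel₀ two_ne_zero ((hs Z hZ).trans (h Z hZ).symm)

/-- Every linear functional on a fibre is represented by a vector. -/
theorem exists_inner_eq [FiniteDimensional ℝ F] (g : SemiRiemannianMetric (E := E) F V)
    (φ : V x →L[ℝ] ℝ) :
    ∃ v, ∀ w, g.inner x v w = φ w := by
  have : FiniteDimensional ℝ (V x) := VectorBundle.finiteDimensional ℝ F V x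
  have hinj : Function.Injective (fiberForm g x : V x →ₗ[ℝ] Module.Dual ℝ (V x)) :=
    (injective_iff_map_eq_zero _).2 fun v hv ↦
      g.nondegenerate x v fun w ↦ DFunLike.congr_fun hv w
  obtain ⟨v, hv⟩ := (LinearEquiv.ofInjectiveOfFinrankEq _ hinj
    Subspace.dual_finrank_eq.symm).surjective φ.toLinearMap
  exact ⟨v, fun w ↦ DFunLike.congr_fun hv w⟩

theorem contMDiffAt_matrix_det {ι : Type*} [Fintype ι] [DecidableEq ι] {A : M → Matrix ι ι ℝ}
    (hA : ∀ i j, CMDiffAt ∞ (fun y ↦ A y i j) x) : CMDiffAt ∞ (fun y ↦ (A y).det) x := by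
  simp only [Matrix.det_apply']
  exact contMDiffAt_finsetSum fun σ _ ↦
    contMDiffAt_const.mul (contMDiffAt_finsetProd fun i _ ↦ hA _ _)

theorem contMDiffAt_matrix_inv {ι : Type*} [Fintype ι] [DecidableEq ι] {A : M → Matrix ι ι ℝ}
    (hA : ∀ i j, CMDiffAt ∞ (fun y ↦ A y i j) x) (hx : IsUnit (A x).det) (i j : ι) :
    CMDiffAt ∞ (fun y ↦ (A y)⁻¹ i j) x := by
  simp only [Matrix.inv_def, Matrix.smul_apply, Ring.inverse_eq_inv', smul_eq_mul,
    Matrix.adjugate_apply]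
  refine ((contMDiffAt_matrix_det hA).inv₀ hx.ne_zero).mul (contMDiffAt_matrix_det fun k l ↦ ?_)
  by_cases hk : k = j
  · subst hk
    simpa using contMDiffAt_const
  · simpa [Matrix.updateRow_ne hk] using hA k l

/-- A section is smooth if its products with the vectors of a smooth frame are: its coefficients
are obtained from these products by means of the inverse Gram matrix. -/
theorem contMDiffAt_of_pairing [FiniteDimensional ℝ F] [ContMDiffVectorBundle ∞ F V 𝓘(ℝ, E)]
    {v : Π x, V x}
    (h : ∀ i, CMDiffAt ∞ (pairing g v (frame (F := F) x i)) x) : CMDiffAt ∞ (T% v) x := by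
  have hx := mem_baseSet_trivializationAt F V x
  have hE (i) : CMDiffAt ∞ (T% (frame (F := F) (V := V) x i)) x :=
    contMDiffAt_localFrame_of_mem _ _ _ i hx
  let G (y : M) : Matrix (Fin (finrank ℝ F)) (Fin (finrank ℝ F)) ℝ :=
    gram (fiberForm g y) fun i ↦ frame (F := F) x i y
  have hG (i j) : CMDiffAt ∞ (fun y ↦ G y i j) x := contMDiffAt_pairing (hE i) (hE j)
  have hGu (y) (hy : y ∈ (trivializationAt F V x).baseSet) : IsUnit (G y).det := by
    convert! isUnit_det_gram (G := fiberForm g y) (g.nondegenerate y)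
      ((trivializationAt F V x).basisAt (finBasis ℝ F) hy) using 4 with i
    simp [frame, hy]
  let c (j : Fin (finrank ℝ F)) (y : M) : ℝ := ∑ k, pairing g v (frame (F := F) x k) y * (G y)⁻¹ k j
  have hc (j) : CMDiffAt ∞ (c j) x :=
    contMDiffAt_finsetSum fun k _ ↦ (h k).mul (contMDiffAt_matrix_inv hG (hGu x hx) k j)
  have hsum : CMDiffAt ∞ (T% fun y ↦ ∑ j, c j y • frame (F := F) (V := V) x j y) x :=
    .sum_section fun j _ ↦ (hc j).smul_section (hE j)
  refine hsum.congr_of_eventuallyEq ?_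
  filter_upwards [(trivializationAt F V x).open_baseSet.mem_nhds hx] with y hy
  let β := (trivializationAt F V x).basisAt (finBasis ℝ F) hy
  have hβ (i) : frame (F := F) (V := V) x i y = β i := by simp [frame, hy, β]
  have hw : (fun k ↦ pairing g v (frame (F := F) x k) y) = Matrix.vecMul (β.repr (v y)) (G y) := by
    funext k
    have : v y = ∑ j, β.repr (v y) j • β j := (β.sum_repr _).symm
    simp only [pairing, hβ, Matrix.vecMul, dotProduct, G, gram, Matrix.of_apply, fiberForm_apply]
    conv_lhs => rw [this]
    simp only [map_sum, map_smul, sum_apply, smul_apply,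
      smul_eq_mul]
  have hcr (j) : c j y = β.repr (v y) j := by
    have : c j y = Matrix.vecMul (fun k ↦ pairing g v (frame (F := F) x k) y) (G y)⁻¹ j := rfl
    rw [this, hw, Matrix.vecMul_vecMul, Matrix.mul_nonsing_inv _ (hGu y hy), Matrix.vecMul_one]
  simp only [hcr, hβ, β.sum_repr]

end
end Algebroid

namespace SemiRiemannian

section

variable {E : Type*} [NormedAddCommGroup E] [NormedSpace ℝ E]
  {M : Type*} [TopologicalSpace M] [ChartedSpace E M]

local notation "ℒ" => VectorField.mlieBracket 𝓘(ℝ, E)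

/-! ### The Koszul formula on a semi-Riemannian manifold -/

theorem mlieBracket_congr {x : M} {A A' B B' : Π x : M, TangentSpace 𝓘(ℝ, E) x}
    (hA : ∀ᶠ y in 𝓝 x, A y = A' y) (hB : ∀ᶠ y in 𝓝 x, B y = B' y) :
    ℒ A B x = ℒ A' B' x :=
  Filter.EventuallyEq.mlieBracket_vectorField_eq hA hB

theorem differential_const {X : Π x : M, TangentSpace 𝓘(ℝ, E) x} {x : M} (c : ℝ) :
    differential (fun _ ↦ c) X x = 0 :=
  Algebroid.deriv_const (ρ := anchor) c

variable [IsManifold 𝓘(ℝ, E) ∞ M]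
  {g : SemiRiemannianMetric (E := E) E (TangentSpace 𝓘(ℝ, E) : M → Type _)}
  {X X' Y Y' Z : Π x : M, TangentSpace 𝓘(ℝ, E) x} {f h : M → ℝ} {x : M}

theorem eventually_mdifferentiableAt (hX : CMDiffAt ∞ (T% X) x) :
    ∀ᶠ y in 𝓝 x, MDiffAt (T% X) y :=
  ((contMDiffAt_iff_contMDiffAt_nhds (n := 1) (by simp)).1 (hX.of_le (by simp))).mono
    fun _ hy ↦ hy.mdifferentiableAt (by simp)

theorem contMDiffAt_mlieBracket [CompleteSpace E]
    (hX : CMDiffAt ∞ (T% X) x) (hY : CMDiffAt ∞ (T% Y) x) : CMDiffAt ∞ (T% (ℒ X Y)) x := by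
  have : IsManifold 𝓘(ℝ, E) (minSmoothness ℝ 2) M := by
    rw [minSmoothness_of_isRCLikeNormedField]; infer_instance
  have : IsManifold 𝓘(ℝ, E) (((⊤ : ℕ∞) : WithTop ℕ∞) + 1) M := ‹IsManifold 𝓘(ℝ, E) ∞ M›
  exact ContMDiffAt.mlieBracket_vectorField (m := ⊤) (n := ⊤) (𝕜 := ℝ) hX hY (by simp)

theorem contMDiffAt_differential (hX : CMDiffAt ∞ (T% X) x) (hf : CMDiffAt ∞ f x) :
    CMDiffAt ∞ (differential f X) x :=
  (contMDiff_snd_tangentBundle_modelSpace ℝ 𝓘(ℝ, ℝ)).contMDiffAt.comp x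
    (ContMDiffAt.clm_apply_of_inCoordinates (hf.mfderiv_const (m := ∞) (by simp)) hX hf)

/-- The derivatives of the coefficients of `Z` cancel in the Koszul formula. -/
theorem koszul_tensorial [CompleteSpace E] (hX : MDiffAt (T% X) x) (hY : MDiffAt (T% Y) x) :
    TensorialAt 𝓘(ℝ, E) E (fun Z ↦ Algebroid.koszul (F := E) anchor ℒ g X Y Z x) x where
  smul {f Z} hf hZ := by
    simp only [Algebroid.koszul, Algebroid.pairing_smul_left, Algebroid.pairing_smul_right,
      Algebroid.deriv_mul hf (Algebroid.mdifferentiableAt_pairing hY hZ),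
      Algebroid.deriv_mul hf (Algebroid.mdifferentiableAt_pairing hZ hX),
      Algebroid.deriv_smul_left]
    simp only [Algebroid.pairing, VectorField.mlieBracket_smul_left hf hZ,
      VectorField.mlieBracket_smul_right hf hZ, map_add, map_smul, Pi.mul_apply, add_apply,
      smul_apply, smul_eq_mul, g.symm x (Z x) (Y x)]
    simp only [Algebroid.deriv_eq_mvfderiv, anchor, ContinuousLinearMap.id_apply]
    ring
  add {Z Z'} hZ hZ' := by
    simp only [Algebroid.koszul, Algebroid.pairing_add_left, Algebroid.pairing_add_right,
      Algebroid.deriv_add (Algebroid.mdifferentiableAt_pairing hY hZ)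
        (Algebroid.mdifferentiableAt_pairing hY hZ'),
      Algebroid.deriv_add (Algebroid.mdifferentiableAt_pairing hZ hX)
        (Algebroid.mdifferentiableAt_pairing hZ' hX),
      Algebroid.deriv_add_left]
    simp only [Algebroid.pairing, VectorField.mlieBracket_add_left hZ hZ',
      VectorField.mlieBracket_add_right hZ hZ', map_add, Pi.add_apply, add_apply]
    ring

/-- The Koszul formula: the vector it asks for exists, since its right-hand side is tensorial in
`Z` and the metric is nondegenerate. -/
theorem two_mul_inner_leviCivita [FiniteDimensional ℝ E] (hX : MDiffAt (T% X) x)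
    (hY : MDiffAt (T% Y) x) (hZ : MDiffAt (T% Z) x) :
    2 * g.inner x (leviCivita g X Y x) (Z x) =
      Algebroid.koszul (F := E) anchor ℒ g X Y Z x := by
  have := FiniteDimensional.complete ℝ E
  have hT := koszul_tensorial (g := g) hX hY
  obtain ⟨v, hv⟩ := Algebroid.exists_inner_eq (F := E) (x := x) g
    ((2 : ℝ)⁻¹ • TensorialAt.mkHom _ x hT)
  have key {Z} (hZ : MDiffAt (T% Z) x) : 2 * g.inner x v (Z x) =
      Algebroid.koszul (F := E) anchor ℒ g X Y Z x := by
    have := hT.mkHom_apply hZ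
    simp [hv, this]
  have : leviCivita g X Y x = v :=
    Algebroid.leviCivita_eq fun Z hZ ↦ key (hZ.mdifferentiableAt (by simp))
  rw [this, key hZ]

/-! ### Properties of the Levi-Civita connection -/

theorem leviCivita_congr (hX : ∀ᶠ y in 𝓝 x, X y = X' y) (hY : ∀ᶠ y in 𝓝 x, Y y = Y' y) :
    leviCivita g X Y x = leviCivita g X' Y' x :=
  Algebroid.leviCivita_congr mlieBracket_congr hX hY

variable [FiniteDimensional ℝ E]

/-- The products of `∇_X Y` with the vectors of a smooth frame are smooth by the Koszul formula. -/
theorem contMDiffAt_leviCivita (hX : CMDiffAt ∞ (T% X) x) (hY : CMDiffAt ∞ (T% Y) x) :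
    CMDiffAt ∞ (T% (leviCivita g X Y)) x := by
  have := FiniteDimensional.complete ℝ E
  have hx := mem_baseSet_trivializationAt E (TangentSpace 𝓘(ℝ, E)) x
  refine Algebroid.contMDiffAt_of_pairing (g := g) fun i ↦ ?_
  let Z := Algebroid.frame (F := E) (V := (TangentSpace 𝓘(ℝ, E) : M → Type _)) x i
  have hZ : CMDiffAt ∞ (T% Z) x := contMDiffAt_localFrame_of_mem _ _ _ i hx
  have hk : CMDiffAt ∞ (Algebroid.koszul (F := E) anchor ℒ g X Y Z) x := by
    refine (((((contMDiffAt_differential hX (Algebroid.contMDiffAt_pairing hY hZ)).add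
      (contMDiffAt_differential hY (Algebroid.contMDiffAt_pairing hZ hX))).sub
      (contMDiffAt_differential hZ (Algebroid.contMDiffAt_pairing hX hY))).add
      (Algebroid.contMDiffAt_pairing (contMDiffAt_mlieBracket hX hY) hZ)).sub
      (Algebroid.contMDiffAt_pairing (contMDiffAt_mlieBracket hY hZ) hX)).add
      (Algebroid.contMDiffAt_pairing (contMDiffAt_mlieBracket hZ hX) hY)
  refine ((contMDiffAt_const (c := (2 : ℝ)⁻¹)).mul hk).congr_of_eventuallyEq ?_
  filter_upwards [eventually_mdifferentiableAt hX, eventually_mdifferentiableAt hY,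
    eventually_mdifferentiableAt hZ] with y h₁ h₂ h₃
  rw [Pi.mul_apply, ← two_mul_inner_leviCivita h₁ h₂ h₃]
  simp [Algebroid.pairing, Z]

/-- The Levi-Civita connection is metric. -/
theorem differential_pairing (hX : MDiffAt (T% X) x) (hY : MDiffAt (T% Y) x)
    (hZ : MDiffAt (T% Z) x) : differential (Algebroid.pairing g Y Z) X x =
      g.inner x (leviCivita g X Y x) (Z x) + g.inner x (Y x) (leviCivita g X Z x) := by
  have h₁ := two_mul_inner_leviCivita (g := g) hX hY hZ
  have h₂ := two_mul_inner_leviCivita (g := g) hX hZ hY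
  have hc (A B) : Algebroid.pairing g A B = Algebroid.pairing g B A :=
    funext fun y ↦ g.symm y _ _
  rw [g.symm x (Y x)]
  simp only [Algebroid.koszul, hc Z X, hc X Y, hc Z Y] at h₁ h₂
  simp only [Algebroid.pairing, VectorField.mlieBracket_swap_apply (V := Z),
    VectorField.mlieBracket_swap_apply (V := Y) (W := X), map_neg, neg_apply] at h₁ h₂
  change Algebroid.deriv anchor X _ x = _
  linarith

/-- The Levi-Civita connection is torsion-free. -/
theorem leviCivita_sub_leviCivita (hX : MDiffAt (T% X) x) (hY : MDiffAt (T% Y) x) :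
    leviCivita g X Y x - leviCivita g Y X x = ℒ X Y x := by
  refine Algebroid.inner_ext (F := E) (g := g) fun Z hZ ↦ ?_
  have hZ := hZ.mdifferentiableAt (by simp)
  have h₁ := two_mul_inner_leviCivita (g := g) hX hY hZ
  have h₂ := two_mul_inner_leviCivita (g := g) hY hX hZ
  have hc (A B) : Algebroid.pairing g A B = Algebroid.pairing g B A :=
    funext fun y ↦ g.symm y _ _
  simp only [Algebroid.koszul, hc Z X, hc X Y, hc Z Y] at h₁ h₂
  simp only [Algebroid.pairing, VectorField.mlieBracket_swap_apply (V := Z),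
    VectorField.mlieBracket_swap_apply (V := Y) (W := X), map_neg, neg_apply] at h₁ h₂
  simp only [map_sub, sub_apply]
  linarith

theorem leviCivita_add_left (hX : MDiffAt (T% X) x) (hX' : MDiffAt (T% X') x)
    (hY : MDiffAt (T% Y) x) :
    leviCivita g (X + X') Y x = leviCivita g X Y x + leviCivita g X' Y x := by
  have := FiniteDimensional.complete ℝ E
  refine Algebroid.inner_ext (F := E) (g := g) fun Z hZ ↦ ?_
  have hZ := hZ.mdifferentiableAt (by simp)
  have h₁ := two_mul_inner_leviCivita (g := g) hX hY hZ
  have h₂ := two_mul_inner_leviCivita (g := g) hX' hY hZ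
  have h₃ := two_mul_inner_leviCivita (g := g) (mdifferentiableAt_add_section hX hX') hY hZ
  simp only [Algebroid.koszul, Algebroid.pairing_add_left, Algebroid.pairing_add_right,
      Algebroid.deriv_add (Algebroid.mdifferentiableAt_pairing hX hY)
        (Algebroid.mdifferentiableAt_pairing hX' hY),
      Algebroid.deriv_add (Algebroid.mdifferentiableAt_pairing hZ hX)
        (Algebroid.mdifferentiableAt_pairing hZ hX'),
      Algebroid.deriv_add_left] at h₁ h₂ h₃
  simp only [Algebroid.pairing, VectorField.mlieBracket_add_left hX hX',
      VectorField.mlieBracket_add_right hX hX', map_add, Pi.add_apply, add_apply] at h₁ h₂ h₃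
  simp only [map_add, add_apply]
  linarith

theorem leviCivita_smul_left (hf : MDiffAt f x) (hX : MDiffAt (T% X) x)
    (hY : MDiffAt (T% Y) x) :
    leviCivita g (f • X) Y x = f x • leviCivita g X Y x := by
  have := FiniteDimensional.complete ℝ E
  refine Algebroid.inner_ext (F := E) (g := g) fun Z hZ ↦ ?_
  have hZ := hZ.mdifferentiableAt (by simp)
  have h₁ := two_mul_inner_leviCivita (g := g) hX hY hZ
  have h₃ := two_mul_inner_leviCivita (g := g) (hf.smul_section hX) hY hZ
  simp only [Algebroid.koszul, Algebroid.pairing_smul_left, Algebroid.pairing_smul_right,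
      Algebroid.deriv_mul hf (Algebroid.mdifferentiableAt_pairing hX hY),
      Algebroid.deriv_mul hf (Algebroid.mdifferentiableAt_pairing hZ hX),
      Algebroid.deriv_smul_left] at h₁ h₃
  simp only [Algebroid.pairing, VectorField.mlieBracket_smul_left hf hX,
      VectorField.mlieBracket_smul_right hf hX, map_add, map_smul, Pi.mul_apply, add_apply,
      smul_apply, smul_eq_mul, g.symm x (Z x) (X x)] at h₁ h₃
  simp only [Algebroid.deriv_eq_mvfderiv, anchor, ContinuousLinearMap.id_apply] at h₁ h₃
  simp only [map_smul, smul_apply, smul_eq_mul]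
  linear_combination h₃ / 2 - f x * h₁ / 2

theorem leviCivita_add_right (hX : MDiffAt (T% X) x) (hY : MDiffAt (T% Y) x)
    (hY' : MDiffAt (T% Y') x) :
    leviCivita g X (Y + Y') x = leviCivita g X Y x + leviCivita g X Y' x := by
  have := FiniteDimensional.complete ℝ E
  have h₁ := leviCivita_sub_leviCivita (g := g) hX (mdifferentiableAt_add_section hY hY')
  rw [VectorField.mlieBracket_add_right hY hY', leviCivita_add_left hY hY' hX,
    ← leviCivita_sub_leviCivita (g := g) hX hY, ← leviCivita_sub_leviCivita (g := g) hX hY'] at h₁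
  rw [sub_eq_iff_eq_add.1 h₁]
  abel

theorem leviCivita_smul_right (hf : MDiffAt f x) (hX : MDiffAt (T% X) x)
    (hY : MDiffAt (T% Y) x) :
    leviCivita g X (f • Y) x = differential f X x • Y x + f x • leviCivita g X Y x := by
  have := FiniteDimensional.complete ℝ E
  have h₁ := leviCivita_sub_leviCivita (g := g) hX (hf.smul_section hY)
  rw [VectorField.mlieBracket_smul_right hf hY, leviCivita_smul_left hf hY hX,
    ← leviCivita_sub_leviCivita (g := g) hX hY] at h₁
  rw [sub_eq_iff_eq_add.1 h₁, smul_sub]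
  change differential f X x • Y x + _ + _ = _
  abel

/-! ### The gradient -/

theorem inner_gradient (v : TangentSpace 𝓘(ℝ, E) x) :
    g.inner x (gradient g f x) v = mfderiv 𝓘(ℝ, E) 𝓘(ℝ, ℝ) f x v :=
  @Classical.epsilon_spec _ (fun u : TangentSpace 𝓘(ℝ, E) x ↦
    ∀ w, g.inner x u w = mfderiv 𝓘(ℝ, E) 𝓘(ℝ, ℝ) f x w)
    (Algebroid.exists_inner_eq (F := E) g (mvfderiv 𝓘(ℝ, E) f x)) v

theorem contMDiffAt_gradient (hf : CMDiffAt ∞ f x) : CMDiffAt ∞ (T% (gradient g f)) x := by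
  have hx := mem_baseSet_trivializationAt E (TangentSpace 𝓘(ℝ, E)) x
  refine Algebroid.contMDiffAt_of_pairing (g := g) fun i ↦ ?_
  refine (contMDiffAt_differential (contMDiffAt_localFrame_of_mem _ _ _ i hx)
    hf).congr_of_eventuallyEq (.of_forall fun y ↦ inner_gradient _)

/-- `g(∇_X ∇f, Y) = Hes(f)(X, Y)`. -/
theorem inner_leviCivita_gradient (hf : CMDiffAt ∞ f x) (hX : MDiffAt (T% X) x)
    (hY : MDiffAt (T% Y) x) :
    g.inner x (leviCivita g X (gradient g f) x) (Y x) = hessian g f X Y x := by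
  have h := differential_pairing (g := g) hX
    ((contMDiffAt_gradient (g := g) hf).mdifferentiableAt (by simp)) hY
  have h₂ : Algebroid.pairing g (gradient g f) Y = differential f Y :=
    funext fun y ↦ inner_gradient _
  rw [inner_gradient, h₂] at h
  rw [hessian, covDerivForm, h]
  exact (add_sub_cancel_right _ _).symm

/-! ### The curvature tensor -/

variable {Z' : Π x : M, TangentSpace 𝓘(ℝ, E) x}

theorem leviCivita_const_smul_left (c : ℝ) (hX : MDiffAt (T% X) x) (hY : MDiffAt (T% Y) x) :
    leviCivita g (c • X) Y x = c • leviCivita g X Y x :=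
  leviCivita_smul_left (f := fun _ ↦ c) mdifferentiableAt_const hX hY

theorem leviCivita_const_smul_right (c : ℝ) (hX : MDiffAt (T% X) x) (hY : MDiffAt (T% Y) x) :
    leviCivita g X (c • Y) x = c • leviCivita g X Y x := by
  have h := leviCivita_smul_right (g := g) (f := fun _ ↦ c) mdifferentiableAt_const hX hY
  rwa [differential_const, zero_smul, zero_add] at h

/-- The curvature of the Levi-Civita connection of a semi-Riemannian metric on `M`. -/
def curvature (g : SemiRiemannianMetric (E := E) E (TangentSpace 𝓘(ℝ, E) : M → Type _))
    (X Y Z : Π x : M, TangentSpace 𝓘(ℝ, E) x) (x : M) : TangentSpace 𝓘(ℝ, E) x :=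
  leviCivita g X (leviCivita g Y Z) x - leviCivita g Y (leviCivita g X Z) x
    - leviCivita g (ℒ X Y) Z x

theorem curvature_add_left (hX : CMDiffAt ∞ (T% X) x) (hX' : CMDiffAt ∞ (T% X') x)
    (hY : CMDiffAt ∞ (T% Y) x) (hZ : CMDiffAt ∞ (T% Z) x) :
    curvature g (X + X') Y Z x = curvature g X Y Z x + curvature g X' Y Z x := by
  have := FiniteDimensional.complete ℝ E
  have d {W : Π x : M, TangentSpace 𝓘(ℝ, E) x} (hW : CMDiffAt ∞ (T% W) x) : MDiffAt (T% W) x :=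
    hW.mdifferentiableAt (by simp)
  have h₁ : ∀ᶠ y in 𝓝 x, leviCivita g (X + X') Z y = (leviCivita g X Z + leviCivita g X' Z) y := by
    filter_upwards [eventually_mdifferentiableAt hX, eventually_mdifferentiableAt hX',
      eventually_mdifferentiableAt hZ] with y h₁ h₂ h₃ using leviCivita_add_left h₁ h₂ h₃
  have h₂ : ∀ᶠ y in 𝓝 x, ℒ (X + X') Y y = (ℒ X Y + ℒ X' Y) y := by
    filter_upwards [eventually_mdifferentiableAt hX, eventually_mdifferentiableAt hX'] with y h₁ h₂
      using VectorField.mlieBracket_add_left h₁ h₂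
  have r (W : Π x : M, TangentSpace 𝓘(ℝ, E) x) : ∀ᶠ y in 𝓝 x, W y = W y := .of_forall fun _ ↦ rfl
  rw [curvature, leviCivita_congr (r Y) h₁, leviCivita_congr h₂ (r Z),
    leviCivita_add_left (d hX) (d hX') (d (contMDiffAt_leviCivita hY hZ)),
    leviCivita_add_right (d hY) (d (contMDiffAt_leviCivita hX hZ))
      (d (contMDiffAt_leviCivita hX' hZ)),
    leviCivita_add_left (d (contMDiffAt_mlieBracket hX hY)) (d (contMDiffAt_mlieBracket hX' hY))
      (d hZ), curvature, curvature]
  abel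

theorem curvature_smul_left (c : ℝ) (hX : CMDiffAt ∞ (T% X) x)
    (hY : CMDiffAt ∞ (T% Y) x) (hZ : CMDiffAt ∞ (T% Z) x) :
    curvature g (c • X) Y Z x = c • curvature g X Y Z x := by
  have := FiniteDimensional.complete ℝ E
  have d {W : Π x : M, TangentSpace 𝓘(ℝ, E) x} (hW : CMDiffAt ∞ (T% W) x) : MDiffAt (T% W) x :=
    hW.mdifferentiableAt (by simp)
  have h₁ : ∀ᶠ y in 𝓝 x, leviCivita g (c • X) Z y = (c • leviCivita g X Z) y := by
    filter_upwards [eventually_mdifferentiableAt hX,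
      eventually_mdifferentiableAt hZ] with y h₁ h₃ using leviCivita_const_smul_left c h₁ h₃
  have h₂ : ∀ᶠ y in 𝓝 x, ℒ (c • X) Y y = (c • ℒ X Y) y := by
    filter_upwards [eventually_mdifferentiableAt hX] with y h₁
      using VectorField.mlieBracket_const_smul_left h₁
  have r (W : Π x : M, TangentSpace 𝓘(ℝ, E) x) : ∀ᶠ y in 𝓝 x, W y = W y := .of_forall fun _ ↦ rfl
  rw [curvature, leviCivita_congr (r Y) h₁, leviCivita_congr h₂ (r Z),
    leviCivita_const_smul_left c (d hX) (d (contMDiffAt_leviCivita hY hZ)),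
    leviCivita_const_smul_right c (d hY) (d (contMDiffAt_leviCivita hX hZ)),
    leviCivita_const_smul_left c (d (contMDiffAt_mlieBracket hX hY)) (d hZ), curvature,
    smul_sub, smul_sub]

theorem curvature_swap (hX : CMDiffAt ∞ (T% X) x)
    (hY : CMDiffAt ∞ (T% Y) x) (hZ : CMDiffAt ∞ (T% Z) x) :
    curvature g Y X Z x = - curvature g X Y Z x := by
  have := FiniteDimensional.complete ℝ E
  have h : ℒ Y X = (-1 : ℝ) • ℒ X Y := by
    rw [VectorField.mlieBracket_swap, neg_one_smul]
  rw [curvature, curvature, h, leviCivita_const_smul_left _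
    ((contMDiffAt_mlieBracket hX hY).mdifferentiableAt (by simp)) (hZ.mdifferentiableAt (by simp)),
    neg_one_smul]
  abel

theorem curvature_add_right (hX : CMDiffAt ∞ (T% X) x) (hY : CMDiffAt ∞ (T% Y) x)
    (hZ : CMDiffAt ∞ (T% Z) x) (hZ' : CMDiffAt ∞ (T% Z') x) :
    curvature g X Y (Z + Z') x = curvature g X Y Z x + curvature g X Y Z' x := by
  have := FiniteDimensional.complete ℝ E
  have d {W : Π x : M, TangentSpace 𝓘(ℝ, E) x} (hW : CMDiffAt ∞ (T% W) x) : MDiffAt (T% W) x :=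
    hW.mdifferentiableAt (by simp)
  have h {W : Π x : M, TangentSpace 𝓘(ℝ, E) x} (hW : CMDiffAt ∞ (T% W) x) :
      ∀ᶠ y in 𝓝 x, leviCivita g W (Z + Z') y = (leviCivita g W Z + leviCivita g W Z') y := by
    filter_upwards [eventually_mdifferentiableAt hW, eventually_mdifferentiableAt hZ,
      eventually_mdifferentiableAt hZ'] with y h₁ h₂ h₃ using leviCivita_add_right h₁ h₂ h₃
  have r (W : Π x : M, TangentSpace 𝓘(ℝ, E) x) : ∀ᶠ y in 𝓝 x, W y = W y := .of_forall fun _ ↦ rfl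
  rw [curvature, leviCivita_congr (r X) (h hY), leviCivita_congr (r Y) (h hX),
    leviCivita_add_right (d hX) (d (contMDiffAt_leviCivita hY hZ))
      (d (contMDiffAt_leviCivita hY hZ')),
    leviCivita_add_right (d hY) (d (contMDiffAt_leviCivita hX hZ))
      (d (contMDiffAt_leviCivita hX hZ')),
    leviCivita_add_right (d (contMDiffAt_mlieBracket hX hY)) (d hZ) (d hZ'), curvature, curvature]
  abel

theorem curvature_smul_right (c : ℝ) (hX : CMDiffAt ∞ (T% X) x) (hY : CMDiffAt ∞ (T% Y) x)
    (hZ : CMDiffAt ∞ (T% Z) x) :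
    curvature g X Y (c • Z) x = c • curvature g X Y Z x := by
  have := FiniteDimensional.complete ℝ E
  have d {W : Π x : M, TangentSpace 𝓘(ℝ, E) x} (hW : CMDiffAt ∞ (T% W) x) : MDiffAt (T% W) x :=
    hW.mdifferentiableAt (by simp)
  have h {W : Π x : M, TangentSpace 𝓘(ℝ, E) x} (hW : CMDiffAt ∞ (T% W) x) :
      ∀ᶠ y in 𝓝 x, leviCivita g W (c • Z) y = (c • leviCivita g W Z) y := by
    filter_upwards [eventually_mdifferentiableAt hW, eventually_mdifferentiableAt hZ]
      with y h₁ h₂ using leviCivita_const_smul_right c h₁ h₂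
  have r (W : Π x : M, TangentSpace 𝓘(ℝ, E) x) : ∀ᶠ y in 𝓝 x, W y = W y := .of_forall fun _ ↦ rfl
  rw [curvature, leviCivita_congr (r X) (h hY), leviCivita_congr (r Y) (h hX),
    leviCivita_const_smul_right c (d hX) (d (contMDiffAt_leviCivita hY hZ)),
    leviCivita_const_smul_right c (d hY) (d (contMDiffAt_leviCivita hX hZ)),
    leviCivita_const_smul_right c (d (contMDiffAt_mlieBracket hX hY)) (d hZ), curvature,
    smul_sub, smul_sub]

/-- The curvature tensor `⟨R(u, v)w, z⟩` at `x`, computed with the local extensions of the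
vectors. -/
def curvatureForm (g : SemiRiemannianMetric (E := E) E (TangentSpace 𝓘(ℝ, E) : M → Type _)) {x : M}
    (u v w z : TangentSpace 𝓘(ℝ, E) x) : ℝ :=
  g.inner x (curvature g (Algebroid.localExtension E u) (Algebroid.localExtension E v)
    (Algebroid.localExtension E w) x) z

/-- Additivity in `u` holds since local extensions are additive and `R(X, Y)Z` is additive in
smooth sections. -/
theorem isBilinearMap_curvatureForm_outer (v w : TangentSpace 𝓘(ℝ, E) x) :
    IsBilinearMap ℝ fun u z ↦ curvatureForm g u v w z where
  add_left u u' z := by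
    simp only [curvatureForm, Algebroid.localExtension_add]
    rw [curvature_add_left] <;> simp [Algebroid.contMDiffAt_localExtension]
  smul_left c u z := by
    simp only [curvatureForm, Algebroid.localExtension_smul]
    rw [curvature_smul_left] <;> simp [Algebroid.contMDiffAt_localExtension]
  add_right u z z' := by simp [curvatureForm]
  smul_right c u z := by simp [curvatureForm]

theorem isBilinearMap_curvatureForm_inner (u z : TangentSpace 𝓘(ℝ, E) x) :
    IsBilinearMap ℝ fun v w ↦ curvatureForm g u v w z := by
  have hs (v w : TangentSpace 𝓘(ℝ, E) x) : curvatureForm g u v w z = - curvatureForm g v u w z := by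
    rw [curvatureForm, curvature_swap, curvatureForm] <;>
      simp [Algebroid.contMDiffAt_localExtension]
  refine ⟨fun v v' w ↦ ?_, fun c v w ↦ ?_, fun v w w' ↦ ?_, fun c v w ↦ ?_⟩
  · rw [hs, hs, hs, (isBilinearMap_curvatureForm_outer u w).add_left, neg_add]
  · rw [hs, hs, (isBilinearMap_curvatureForm_outer u w).smul_left, smul_neg]
  · simp only [curvatureForm, Algebroid.localExtension_add]
    rw [curvature_add_right] <;> simp [Algebroid.contMDiffAt_localExtension]
  · simp only [curvatureForm, Algebroid.localExtension_smul]
    rw [curvature_smul_right] <;> simp [Algebroid.contMDiffAt_localExtension]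

/-! ### The Hessian and the square of the differential -/

/-- The tensor `Hes(f) + df ⊗ df` at `x`, which governs the curvature of the graded metric. -/
def hessianForm (g : SemiRiemannianMetric (E := E) E (TangentSpace 𝓘(ℝ, E) : M → Type _))
    (f : M → ℝ) {x : M} (u v : TangentSpace 𝓘(ℝ, E) x) : ℝ :=
  hessian g f (Algebroid.localExtension E u) (Algebroid.localExtension E v) x +
    mvfderiv 𝓘(ℝ, E) f x u * mvfderiv 𝓘(ℝ, E) f x v

/-- Bilinearity follows from `Hes(f)(u, v) = g(∇_u ∇f, v)`. -/
theorem isBilinearMap_hessianForm (hf : CMDiffAt ∞ f x) :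
    IsBilinearMap ℝ fun u v : TangentSpace 𝓘(ℝ, E) x ↦ hessianForm g f u v := by
  have hσ (u : TangentSpace 𝓘(ℝ, E) x) : MDiffAt (T% (Algebroid.localExtension E u)) x :=
    (Algebroid.contMDiffAt_localExtension u).mdifferentiableAt (by simp)
  have hG : MDiffAt (T% (gradient g f)) x := (contMDiffAt_gradient hf).mdifferentiableAt (by simp)
  have h (u v : TangentSpace 𝓘(ℝ, E) x) : hessianForm g f u v =
      g.inner x (leviCivita g (Algebroid.localExtension E u) (gradient g f) x) v +
        g.inner x (gradient g f x) u * g.inner x (gradient g f x) v := by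
    have hd (u : TangentSpace 𝓘(ℝ, E) x) : g.inner x (gradient g f x) u = mvfderiv 𝓘(ℝ, E) f x u :=
      inner_gradient u
    rw [hd, hd, hessianForm, ← inner_leviCivita_gradient hf (hσ u) (hσ v),
      Algebroid.localExtension_self]
  simp only [h]
  refine ⟨fun v v' w ↦ ?_, fun c v w ↦ ?_, fun v w w' ↦ ?_, fun c v w ↦ ?_⟩
  · rw [Algebroid.localExtension_add, leviCivita_add_left (hσ _) (hσ _) hG]
    simp only [map_add, add_apply]
    ring
  · rw [Algebroid.localExtension_smul, leviCivita_const_smul_left c (hσ _) hG]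
    simp only [map_smul, smul_apply, smul_eq_mul]
    ring
  · simp only [map_add]
    ring
  · simp only [map_smul, smul_eq_mul]
    ring

/-- The `g`-trace of `df ⊗ df` is `|∇f|²`. -/
theorem sum_inv_gram_mul_mfderiv_mul_mfderiv {ι : Type*} [Fintype ι] [DecidableEq ι]
    (b : Basis ι ℝ (TangentSpace 𝓘(ℝ, E) x)) :
    ∑ i, ∑ j, (gram (Algebroid.fiberForm g x) b)⁻¹ i j * (mvfderiv 𝓘(ℝ, E) f x (b i) *
      mvfderiv 𝓘(ℝ, E) f x (b j)) = gradientNormSq g f x := by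
  let φ : TangentSpace 𝓘(ℝ, E) x →ₗ[ℝ] ℝ := (mvfderiv 𝓘(ℝ, E) f x).toLinearMap
  have := sum_inv_gram_mul_eq_trace (G := Algebroid.fiberForm g x) (B := LinearMap.mk₂ ℝ
    (fun u v ↦ φ u * φ v) (by simp [add_mul]) (by simp [mul_assoc]) (by simp [mul_add])
    (by simp [mul_left_comm])) (g.symm x) (g.nondegenerate x) b
    (φ.smulRight (gradient g f x)) (fun u v ↦ by
      simp [Algebroid.fiberForm_apply]
      exact Or.inl (inner_gradient v))
  refine this.trans ?_
  have : FiniteDimensional ℝ (TangentSpace 𝓘(ℝ, E) x) := .of_basis b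
  rw [LinearMap.trace_smulRight]
  exact (inner_gradient _).symm

end

end SemiRiemannian

namespace Graded

section

variable {E : Type*} [NormedAddCommGroup E] [NormedSpace ℝ E]
  {M : Type*} [TopologicalSpace M] [ChartedSpace E M]

local notation "ℒ" => VectorField.mlieBracket 𝓘(ℝ, E)

/-! ### The graded Levi-Civita connection -/

theorem bracket_congr {x : M} {A A' B B' : Π x : M, GradedTangentSpace E x}
    (hA : ∀ᶠ y in 𝓝 x, A y = A' y) (hB : ∀ᶠ y in 𝓝 x, B y = B' y) :
    bracket A B x = bracket A' B' x := by
  have hA₁ : ∀ᶠ y in 𝓝 x, (A y).1 = (A' y).1 := hA.mono fun y hy ↦ by rw [hy]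
  have hB₁ : ∀ᶠ y in 𝓝 x, (B y).1 = (B' y).1 := hB.mono fun y hy ↦ by rw [hy]
  have hA₂ : (fun y ↦ (A y).2) =ᶠ[𝓝 x] fun y ↦ (A' y).2 := hA.mono fun y hy ↦ by simp [hy]
  have hB₂ : (fun y ↦ (B y).2) =ᶠ[𝓝 x] fun y ↦ (B' y).2 := hB.mono fun y hy ↦ by simp [hy]
  rw [bracket, bracket, SemiRiemannian.mlieBracket_congr hA₁ hB₁,
    Algebroid.deriv_congr hA.self_of_nhds hB₂, Algebroid.deriv_congr hB.self_of_nhds hA₂]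

theorem contMDiffAt_exp {θ : C^∞⟮𝓘(ℝ, E), M; ℝ⟯} {x : M} :
    CMDiffAt ∞ (fun y ↦ Real.exp (2 * θ y)) x :=
  (Real.contDiff_exp.contMDiff.comp
    ((contDiff_const.mul contDiff_id).contMDiff.comp θ.contMDiff)).contMDiffAt

theorem differential_exp {θ : C^∞⟮𝓘(ℝ, E), M; ℝ⟯} {X : Π x : M, TangentSpace 𝓘(ℝ, E) x} {x : M} :
    SemiRiemannian.differential (fun y ↦ Real.exp (2 * θ y)) X x =
    2 * Real.exp (2 * θ x) * SemiRiemannian.differential θ X x := by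
  have h₁ : HasDerivAt (fun t : ℝ ↦ Real.exp (2 * t)) (Real.exp (2 * θ x) * 2) (θ x) := by
    simpa using ((hasDerivAt_id (θ x)).const_mul 2).exp
  have h₂ := h₁.hasFDerivAt.hasMFDerivAt.comp x (θ.mdifferentiableAt (x := x)).hasMFDerivAt
  exact (DFunLike.congr_fun h₂.mfderiv (X x)).trans (by
    change SemiRiemannian.differential θ X x * (Real.exp (2 * θ x) * 2) = _
    ring)

variable [IsManifold 𝓘(ℝ, E) ∞ M]
  {g : SemiRiemannianMetric (E := E) E (TangentSpace 𝓘(ℝ, E) : M → Type _)}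
  {θ : C^∞⟮𝓘(ℝ, E), M; ℝ⟯}
  {X Y Z : Π x : M, TangentSpace 𝓘(ℝ, E) x} {h k : M → ℝ} {x : M}

theorem mdifferentiableAt_fst {Z : Π x : M, GradedTangentSpace E x}
    (hZ : CMDiffAt ∞ (fun y ↦ TotalSpace.mk' (E × ℝ) y (Z y)) x) :
    MDiffAt (T% fun y ↦ (Z y).1) x := by
  have := contDiff_fst.contMDiff.contMDiffAt.comp x ((contMDiffAt_section _).1 hZ)
  exact ContMDiffAt.mdifferentiableAt ((contMDiffAt_section _).2 this) (by simp)

theorem mdifferentiableAt_snd {Z : Π x : M, GradedTangentSpace E x}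
    (hZ : CMDiffAt ∞ (fun y ↦ TotalSpace.mk' (E × ℝ) y (Z y)) x) :
    MDifferentiableAt 𝓘(ℝ, E) 𝓘(ℝ, ℝ) (fun y ↦ (Z y).2) x := by
  have := contDiff_snd.contMDiff.contMDiffAt.comp x ((contMDiffAt_section _).1 hZ)
  exact ContMDiffAt.mdifferentiableAt this (by simp)

theorem pairing_metric (A B : Π x : M, GradedTangentSpace E x) :
    Algebroid.pairing (metric g θ) A B =
      Algebroid.pairing g (fun y ↦ (A y).1) (fun y ↦ (B y).1) +
        (fun y ↦ Real.exp (2 * θ y)) * ((fun y ↦ (A y).2) * fun y ↦ (B y).2) := rfl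

/-- The Levi-Civita connection of the graded metric, read off from the Koszul formula: the terms
without `ξ` make up the Koszul formula of `g`, the other ones come from the derivatives of
`e^{2θ}` and of the coefficients of `ξ`. -/
theorem leviCivita_eq [FiniteDimensional ℝ E] (hX : MDiffAt (T% X) x) (hY : MDiffAt (T% Y) x)
    (hh : MDiffAt h x) (hk : MDiffAt k x) :
    leviCivita g θ (fun y ↦ (X y, h y)) (fun y ↦ (Y y, k y)) x =
      (SemiRiemannian.leviCivita g X Y x
          - (h x * k x * Real.exp (2 * θ x)) • SemiRiemannian.gradient g θ x,
        SemiRiemannian.differential k X x + k x * SemiRiemannian.differential θ X x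
          + h x * SemiRiemannian.differential θ Y x) := by
  refine Algebroid.leviCivita_eq (F := E × ℝ) (V := GradedTangentSpace E) fun W hZ ↦ ?_
  obtain ⟨Z, l, rfl⟩ : ∃ (Z : Π x : M, TangentSpace 𝓘(ℝ, E) x) (l : M → ℝ),
    W = fun y ↦ (Z y, l y) := ⟨fun y ↦ (W y).1, fun y ↦ (W y).2, rfl⟩
  have hZ₁ : MDiffAt (T% Z) x := mdifferentiableAt_fst hZ
  have hl : MDiffAt l x := mdifferentiableAt_snd hZ
  have he : MDiffAt (fun y ↦ Real.exp (2 * θ y)) x :=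
    contMDiffAt_exp.mdifferentiableAt (by simp)
  have hK := SemiRiemannian.two_mul_inner_leviCivita (g := g) hX hY hZ₁
  have hd (A : Π x : M, TangentSpace 𝓘(ℝ, E) x) (a : M → ℝ) (f : M → ℝ) :
      Algebroid.deriv anchor (fun y ↦ ((A y, a y) : GradedTangentSpace E y)) f x =
        Algebroid.deriv SemiRiemannian.anchor A f x := rfl
  have hD (A : Π x : M, TangentSpace 𝓘(ℝ, E) x) (f : M → ℝ) :
      SemiRiemannian.differential f A x = Algebroid.deriv SemiRiemannian.anchor A f x := rfl
  have hE (A : Π x : M, TangentSpace 𝓘(ℝ, E) x) := (hD A _).symm.trans (differential_exp (θ := θ))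
  have hm {a b : M → ℝ} (ha : MDiffAt a x) (hb : MDiffAt b x) : MDiffAt (a * b) x := ha.mul hb
  have hp {A B : Π x : M, TangentSpace 𝓘(ℝ, E) x} (hA : MDiffAt (T% A) x) (hB : MDiffAt (T% B) x) :=
    Algebroid.mdifferentiableAt_pairing (g := g) hA hB
  simp only [Algebroid.koszul, pairing_metric, hd, hD,
    Algebroid.deriv_add (hp hY hZ₁) (hm he (hm hk hl)),
    Algebroid.deriv_add (hp hZ₁ hX) (hm he (hm hl hh)),
    Algebroid.deriv_add (hp hX hY) (hm he (hm hh hk)),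
    Algebroid.deriv_mul he (hm hk hl), Algebroid.deriv_mul he (hm hl hh),
    Algebroid.deriv_mul he (hm hh hk), Algebroid.deriv_mul hk hl, Algebroid.deriv_mul hl hh,
    Algebroid.deriv_mul hh hk, hE] at hK ⊢
  have hG : g.inner x (SemiRiemannian.gradient g θ x) (Z x) =
    Algebroid.deriv SemiRiemannian.anchor Z θ x := SemiRiemannian.inner_gradient _
  simp only [metric, form_apply, bracket, hd, Algebroid.pairing, Pi.add_apply, Pi.mul_apply,
    map_sub, map_smul, sub_apply, smul_apply, smul_eq_mul, hG] at hK ⊢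
  linear_combination hK

theorem leviCivita_congr {A A' B B' : Π x : M, GradedTangentSpace E x}
    (hA : ∀ᶠ y in 𝓝 x, A y = A' y) (hB : ∀ᶠ y in 𝓝 x, B y = B' y) :
    leviCivita g θ A B x = leviCivita g θ A' B' x :=
  Algebroid.leviCivita_congr bracket_congr hA hB

/-- The form `α` is `dθ`. -/
theorem alpha_eq [FiniteDimensional ℝ E] (hX : MDiffAt (T% X) x) :
    alpha g θ X x = SemiRiemannian.differential θ X x := by
  have h₀ : MDiffAt (T% (fun y : M ↦ (0 : TangentSpace 𝓘(ℝ, E) y))) x :=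
    mdifferentiable_zeroSection _ _ x
  have h := leviCivita_eq (g := g) (θ := θ) h₀ hX
    (mdifferentiableAt_const (c := (1 : ℝ))) (mdifferentiableAt_const (c := (0 : ℝ)))
  refine (congrArg Prod.snd h).trans ?_
  change SemiRiemannian.differential (fun _ ↦ (0 : ℝ)) _ x + 0 * _ +
    1 * SemiRiemannian.differential θ X x = _
  rw [SemiRiemannian.differential_const, zero_mul, one_mul, add_zero, zero_add]

/-! ### The graded curvature tensor -/

/-- The second covariant derivative along sections with constant coefficients of `ξ`. -/
theorem leviCivita_leviCivita_eq [FiniteDimensional ℝ E] (a b c : ℝ) (hX : CMDiffAt ∞ (T% X) x)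
    (hY : CMDiffAt ∞ (T% Y) x) (hZ : CMDiffAt ∞ (T% Z) x) :
    leviCivita g θ (fun y ↦ (X y, a)) (leviCivita g θ (fun y ↦ (Y y, b)) (fun y ↦ (Z y, c))) x =
      (SemiRiemannian.leviCivita g X (SemiRiemannian.leviCivita g Y Z) x
        - (b * c * Real.exp (2 * θ x)) •
          SemiRiemannian.leviCivita g X (SemiRiemannian.gradient g θ) x
        - (2 * (b * c) * Real.exp (2 * θ x) * SemiRiemannian.differential θ X x
          + a * (c * SemiRiemannian.differential θ Y x + b * SemiRiemannian.differential θ Z x)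
            * Real.exp (2 * θ x)) • SemiRiemannian.gradient g θ x,
       c * SemiRiemannian.differential (SemiRiemannian.differential θ Y) X x
        + b * SemiRiemannian.differential (SemiRiemannian.differential θ Z) X x
        + (c * SemiRiemannian.differential θ Y x + b * SemiRiemannian.differential θ Z x)
          * SemiRiemannian.differential θ X x
        + a * (SemiRiemannian.differential θ (SemiRiemannian.leviCivita g Y Z) x
          - b * c * Real.exp (2 * θ x) * SemiRiemannian.gradientNormSq g θ x)) := by
  have d {W : Π x : M, TangentSpace 𝓘(ℝ, E) x} (hW : CMDiffAt ∞ (T% W) x) : MDiffAt (T% W) x :=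
    hW.mdifferentiableAt (by simp)
  have hθ : CMDiffAt ∞ θ x := θ.contMDiff x
  have he : MDiffAt (fun y ↦ Real.exp (2 * θ y)) x := contMDiffAt_exp.mdifferentiableAt (by simp)
  have hcst (r : ℝ) : MDiffAt (fun _ : M ↦ r) x := mdifferentiableAt_const
  have hG : MDiffAt (T% (SemiRiemannian.gradient g θ)) x :=
    d (SemiRiemannian.contMDiffAt_gradient hθ)
  have hdθ {A : Π x : M, TangentSpace 𝓘(ℝ, E) x} (hA : CMDiffAt ∞ (T% A) x) :
      MDiffAt (SemiRiemannian.differential θ A) x :=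
    (SemiRiemannian.contMDiffAt_differential hA hθ).mdifferentiableAt (by simp)
  let φ : M → ℝ := (fun _ ↦ -(b * c)) * fun y ↦ Real.exp (2 * θ y)
  let ψ : M → ℝ := (fun _ ↦ c) * SemiRiemannian.differential θ Y +
    (fun _ ↦ b) * SemiRiemannian.differential θ Z
  have hφ : MDiffAt φ x := (hcst _).mul he
  have hψ : MDiffAt ψ x := ((hcst _).mul (hdθ hY)).add ((hcst _).mul (hdθ hZ))
  have hev : ∀ᶠ y in 𝓝 x, leviCivita g θ (fun y ↦ (Y y, b)) (fun y ↦ (Z y, c)) y =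
      ((SemiRiemannian.leviCivita g Y Z + φ • SemiRiemannian.gradient g θ) y, ψ y) := by
    filter_upwards [SemiRiemannian.eventually_mdifferentiableAt hY,
      SemiRiemannian.eventually_mdifferentiableAt hZ] with y h₁ h₂
    rw [leviCivita_eq h₁ h₂ mdifferentiableAt_const mdifferentiableAt_const]
    refine Prod.ext ?_ ?_
    · simp [φ, sub_eq_add_neg]
    · simp [ψ, SemiRiemannian.differential_const]
  have hφd : SemiRiemannian.differential φ X x =
      -(b * c) * (2 * Real.exp (2 * θ x) * SemiRiemannian.differential θ X x) := by
    rw [← differential_exp]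
    have := Algebroid.deriv_mul (ρ := SemiRiemannian.anchor) (X := X) (hcst (-(b * c))) he
    rw [Algebroid.deriv_const, zero_mul, add_zero] at this
    exact this
  have hψd : SemiRiemannian.differential ψ X x =
      c * SemiRiemannian.differential (SemiRiemannian.differential θ Y) X x +
        b * SemiRiemannian.differential (SemiRiemannian.differential θ Z) X x := by
    have := Algebroid.deriv_add (ρ := SemiRiemannian.anchor) (X := X)
      ((hcst c).mul (hdθ hY)) ((hcst b).mul (hdθ hZ))
    rw [Algebroid.deriv_mul (hcst _) (hdθ hY), Algebroid.deriv_mul (hcst _) (hdθ hZ),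
      Algebroid.deriv_const, Algebroid.deriv_const, zero_mul, add_zero, zero_mul, add_zero] at this
    exact this
  have hYZ := d (SemiRiemannian.contMDiffAt_leviCivita (g := g) hY hZ)
  have hg : SemiRiemannian.differential θ
      (SemiRiemannian.leviCivita g Y Z + φ • SemiRiemannian.gradient g θ) x =
      SemiRiemannian.differential θ (SemiRiemannian.leviCivita g Y Z) x
          - b * c * Real.exp (2 * θ x) * SemiRiemannian.gradientNormSq g θ x := by
    have h₁ : SemiRiemannian.gradientNormSq g θ x =
      SemiRiemannian.differential θ (SemiRiemannian.gradient g θ) x :=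
        SemiRiemannian.inner_gradient _
    have h₂ := Algebroid.deriv_add_left (ρ := SemiRiemannian.anchor) (f := θ) (x := x)
      (X := SemiRiemannian.leviCivita g Y Z) (X' := φ • SemiRiemannian.gradient g θ)
    rw [Algebroid.deriv_smul_left] at h₂
    refine h₂.trans ?_
    rw [h₁, sub_eq_add_neg, ← neg_mul, ← neg_mul]
    rfl
  rw [leviCivita_congr (.of_forall fun _ ↦ rfl) hev,
    leviCivita_eq (d hX) (mdifferentiableAt_add_section hYZ (hφ.smul_section hG)) (hcst a) hψ,
    SemiRiemannian.leviCivita_add_right (d hX) hYZ (hφ.smul_section hG),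
    SemiRiemannian.leviCivita_smul_right hφ (d hX) hG, hφd, hψd, hg]
  refine Prod.ext ?_ ?_
  · simp only [φ, ψ, Pi.mul_apply, Pi.add_apply]
    module
  · simp only [ψ, Pi.mul_apply, Pi.add_apply]

/-- The curvature of the graded metric on sections with constant `ξ`-coefficients. The terms in
`dθ` and `Hes(θ)` combine into the tensor `Hes(θ) + dθ ⊗ dθ`. -/
theorem inner_curvature_eq [FiniteDimensional ℝ E] (u v w z : TangentSpace 𝓘(ℝ, E) x)
    (a b c e : ℝ) :
    form g θ x (Algebroid.curvature (F := E × ℝ) anchor bracket (metric g θ)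
        (fun y ↦ (Algebroid.localExtension E u y, a)) (fun y ↦ (Algebroid.localExtension E v y, b))
        (fun y ↦ (Algebroid.localExtension E w y, c)) x) (z, e) =
      SemiRiemannian.curvatureForm g u v w z + Real.exp (2 * θ x) *
        (c * (a * SemiRiemannian.hessianForm g θ v z - b * SemiRiemannian.hessianForm g θ u z)
          + e * (c * (SemiRiemannian.hessianForm g θ u v - SemiRiemannian.hessianForm g θ v u)
            + b * SemiRiemannian.hessianForm g θ u w
            - a * SemiRiemannian.hessianForm g θ v w)) := by
  have := FiniteDimensional.complete ℝ E
  have hσ (u : TangentSpace 𝓘(ℝ, E) x) : CMDiffAt ∞ (T% (Algebroid.localExtension E u)) x :=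
    Algebroid.contMDiffAt_localExtension u
  have d {W : Π x : M, TangentSpace 𝓘(ℝ, E) x} (hW : CMDiffAt ∞ (T% W) x) : MDiffAt (T% W) x :=
    hW.mdifferentiableAt (by simp)
  have hθ : CMDiffAt ∞ θ x := θ.contMDiff x
  set X := Algebroid.localExtension E u
  set Y := Algebroid.localExtension E v
  set Z := Algebroid.localExtension E w
  have hX : CMDiffAt ∞ (T% X) x := hσ u
  have hY : CMDiffAt ∞ (T% Y) x := hσ v
  have hZ : CMDiffAt ∞ (T% Z) x := hσ w
  have hbr : bracket (fun y ↦ (X y, a)) (fun y ↦ (Y y, b)) = fun y ↦ (ℒ X Y y, (0 : ℝ)) := by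
    funext y
    simp [bracket, Algebroid.deriv_const]
  have h₃ : leviCivita g θ (fun y ↦ (ℒ X Y y, (0 : ℝ))) (fun y ↦ (Z y, c)) x =
      (SemiRiemannian.leviCivita g (ℒ X Y) Z x,
        c * (SemiRiemannian.differential θ (SemiRiemannian.leviCivita g X Y) x -
          SemiRiemannian.differential θ (SemiRiemannian.leviCivita g Y X) x)) := by
    rw [leviCivita_eq (d (SemiRiemannian.contMDiffAt_mlieBracket hX hY)) (d hZ)
      mdifferentiableAt_const mdifferentiableAt_const]
    have h₁ : SemiRiemannian.differential θ (ℒ X Y) x =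
        SemiRiemannian.differential θ (SemiRiemannian.leviCivita g X Y) x -
          SemiRiemannian.differential θ (SemiRiemannian.leviCivita g Y X) x := by
      rw [SemiRiemannian.differential, ← SemiRiemannian.leviCivita_sub_leviCivita (g := g)
        (d hX) (d hY)]
      exact map_sub (mvfderiv 𝓘(ℝ, E) θ x) _ _
    refine Prod.ext ?_ ?_
    · simp
    · simp [SemiRiemannian.differential_const, h₁]
  have hH (u v : TangentSpace 𝓘(ℝ, E) x) : g.inner x (SemiRiemannian.leviCivita g
        (Algebroid.localExtension E u) (SemiRiemannian.gradient g θ) x) v =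
      SemiRiemannian.hessian g θ (Algebroid.localExtension E u)
        (Algebroid.localExtension E v) x := by
    rw [← SemiRiemannian.inner_leviCivita_gradient hθ (d (hσ u)) (d (hσ v)),
      Algebroid.localExtension_self]
  have hD (u : TangentSpace 𝓘(ℝ, E) x) : mvfderiv 𝓘(ℝ, E) θ x u =
      SemiRiemannian.differential θ (Algebroid.localExtension E u) x := by
    rw [SemiRiemannian.differential, Algebroid.localExtension_self]
    rfl
  have hgr (u : TangentSpace 𝓘(ℝ, E) x) : g.inner x (SemiRiemannian.gradient g θ x) u =
      SemiRiemannian.differential θ (Algebroid.localExtension E u) x := by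
    rw [← hD]
    exact SemiRiemannian.inner_gradient _
  have hR : Algebroid.curvature (F := E × ℝ) anchor bracket (metric g θ) (fun y ↦ (X y, a))
      (fun y ↦ (Y y, b)) (fun y ↦ (Z y, c)) x =
      leviCivita g θ (fun y ↦ (X y, a)) (leviCivita g θ (fun y ↦ (Y y, b)) (fun y ↦ (Z y, c))) x
      - leviCivita g θ (fun y ↦ (Y y, b)) (leviCivita g θ (fun y ↦ (X y, a)) (fun y ↦ (Z y, c))) x
      - leviCivita g θ (bracket (fun y ↦ (X y, a)) (fun y ↦ (Y y, b))) (fun y ↦ (Z y, c)) x := rfl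
  rw [hR, hbr, h₃, leviCivita_leviCivita_eq a b c hX hY hZ,
    leviCivita_leviCivita_eq b a c hY hX hZ, form_apply]
  simp only [Prod.fst_sub, Prod.snd_sub, map_sub, map_smul, sub_apply, smul_apply, smul_eq_mul,
    SemiRiemannian.curvatureForm, SemiRiemannian.curvature, SemiRiemannian.hessianForm, hD]
  simp only [X, Y, Z, hH, hgr]
  simp only [SemiRiemannian.hessian, SemiRiemannian.covDerivForm]
  ring

/-- The local extension of `v + hξ` is the one of `v` plus the constant multiple `hξ`. -/
theorem localExtension_eventuallyEq (p : GradedTangentSpace E x) :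
    ∀ᶠ y in 𝓝 x, Algebroid.localExtension (E × ℝ) p y =
      ((Algebroid.localExtension E p.1 y, p.2) : GradedTangentSpace E y) := by
  have hx := mem_baseSet_trivializationAt E (TangentSpace 𝓘(ℝ, E)) x
  filter_upwards [(trivializationAt E (TangentSpace 𝓘(ℝ, E)) x).open_baseSet.mem_nhds hx] with y hy
  have hy' : y ∈ (trivializationAt (E × ℝ) (GradedTangentSpace E : M → Type _) x).baseSet :=
    ⟨hy, Set.mem_univ y⟩
  have hx' : x ∈ (trivializationAt (E × ℝ) (GradedTangentSpace E : M → Type _) x).baseSet :=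
    ⟨hx, Set.mem_univ x⟩
  have hsymm (u : E × ℝ) :
      (trivializationAt (E × ℝ) (GradedTangentSpace E : M → Type _) x).symm y u =
        ((trivializationAt E (TangentSpace 𝓘(ℝ, E) : M → Type _) x).symm y u.1, u.2) := by
    have h := ((trivializationAt (E × ℝ) (GradedTangentSpace E : M → Type _) x).mk_symm hy' u).trans
      (Bundle.Trivialization.prod_symm_apply
        (e₁ := trivializationAt E (TangentSpace 𝓘(ℝ, E) : M → Type _) x)
        (e₂ := Bundle.Trivial.trivialization M ℝ) y u.1 u.2)
    rw [Bundle.Trivial.trivialization_symm_apply] at h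
    exact eq_of_heq (TotalSpace.mk.inj h).2
  have hlin : (trivializationAt (E × ℝ) (GradedTangentSpace E : M → Type _) x).continuousLinearMapAt
      ℝ x p =
        ((trivializationAt E (TangentSpace 𝓘(ℝ, E)) x).continuousLinearMapAt ℝ x p.1, p.2) := by
    rw [Trivialization.continuousLinearMapAt_apply_of_mem _ _ hx',
      Trivialization.continuousLinearMapAt_apply_of_mem _ _ hx]
    rfl
  rw [Algebroid.localExtension, Algebroid.localExtension, hlin, Trivialization.symmL_apply _ hy',
    Trivialization.symmL_apply _ hy, hsymm]

/-! ### The graded scalar curvature -/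

/-- In a basis adapted to the decomposition `TM ⊕ ℝ`, the inverse Gram matrix is block diagonal. -/
theorem inv_gram_prod {ι : Type*} [Fintype ι] [DecidableEq ι]
    (b : Basis ι ℝ (TangentSpace 𝓘(ℝ, E) x)) :
    (gram (Algebroid.fiberForm (metric g θ) x) (b.prod (Basis.singleton Unit ℝ)))⁻¹ =
      Matrix.fromBlocks (gram (Algebroid.fiberForm g x) b)⁻¹ 0 0
        (Matrix.of fun _ _ ↦ (Real.exp (2 * θ x))⁻¹) := by
  have h : gram (Algebroid.fiberForm (metric g θ) x) (b.prod (Basis.singleton Unit ℝ)) =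
      Matrix.fromBlocks (gram (Algebroid.fiberForm g x) b) 0 0
        (Matrix.of fun _ _ ↦ Real.exp (2 * θ x)) := by
    ext (i | i) (j | j) <;>
      simp [gram, Algebroid.fiberForm_apply, metric, form_apply]
  rw [h]
  refine Matrix.inv_eq_left_inv ?_
  rw [Matrix.fromBlocks_multiply, Matrix.nonsing_inv_mul _
    (isUnit_det_gram (G := Algebroid.fiberForm g x) (g.nondegenerate x) b),
    ← Matrix.fromBlocks_one]
  congr 1 <;> ext <;> simp [Matrix.mul_apply, Real.exp_ne_zero]

variable [FiniteDimensional ℝ E]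

/-- The curvature tensor of the graded metric at `x`, in terms of the curvature tensor of `g` and
of the tensor `Hes(θ) + dθ ⊗ dθ`. -/
def gradedCurvatureForm (g : SemiRiemannianMetric (E := E) E (TangentSpace 𝓘(ℝ, E) : M → Type _))
    (θ : C^∞⟮𝓘(ℝ, E), M; ℝ⟯) {x : M} (p q r s : GradedTangentSpace E x) : ℝ :=
  SemiRiemannian.curvatureForm g p.1 q.1 r.1 s.1 + Real.exp (2 * θ x) *
    (r.2 * (p.2 * SemiRiemannian.hessianForm g θ q.1 s.1
        - q.2 * SemiRiemannian.hessianForm g θ p.1 s.1)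
      + s.2 * (r.2 * (SemiRiemannian.hessianForm g θ p.1 q.1
          - SemiRiemannian.hessianForm g θ q.1 p.1)
        + q.2 * SemiRiemannian.hessianForm g θ p.1 r.1
        - p.2 * SemiRiemannian.hessianForm g θ q.1 r.1))

theorem inner_curvature_localExtension (p q r s : GradedTangentSpace E x) :
    (metric g θ).inner x (Algebroid.curvature (F := E × ℝ) anchor bracket (metric g θ)
        (Algebroid.localExtension (E × ℝ) p) (Algebroid.localExtension (E × ℝ) q)
        (Algebroid.localExtension (E × ℝ) r) x) s = gradedCurvatureForm g θ p q r s := by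
  rw [Algebroid.curvature_congr (fun _ ↦ bracket_congr) (localExtension_eventuallyEq p)
    (localExtension_eventuallyEq q) (localExtension_eventuallyEq r)]
  exact inner_curvature_eq p.1 q.1 r.1 s.1 p.2 q.2 r.2 s.2

theorem isBilinearMap_gradedCurvatureForm_outer (q r : GradedTangentSpace E x) :
    IsBilinearMap ℝ fun p s ↦ gradedCurvatureForm g θ p q r s := by
  have hR := SemiRiemannian.isBilinearMap_curvatureForm_outer (g := g) q.1 r.1
  have hT := SemiRiemannian.isBilinearMap_hessianForm (g := g) (θ.contMDiff x)
  constructor <;> intros <;>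
  simp only [gradedCurvatureForm, Prod.fst_add, Prod.snd_add, Prod.smul_fst, Prod.smul_snd,
    hR.add_left, hR.add_right, hR.smul_left, hR.smul_right, hT.add_left, hT.add_right,
    hT.smul_left, hT.smul_right, smul_eq_mul] <;> ring

theorem isBilinearMap_gradedCurvatureForm_inner (p s : GradedTangentSpace E x) :
    IsBilinearMap ℝ fun q r ↦ gradedCurvatureForm g θ p q r s := by
  have hR := SemiRiemannian.isBilinearMap_curvatureForm_inner (g := g) p.1 s.1
  have hT := SemiRiemannian.isBilinearMap_hessianForm (g := g) (θ.contMDiff x)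
  constructor <;> intros <;>
  simp only [gradedCurvatureForm, Prod.fst_add, Prod.snd_add, Prod.smul_fst, Prod.smul_snd,
    hR.add_left, hR.add_right, hR.smul_left, hR.smul_right, hT.add_left, hT.add_right,
    hT.smul_left, hT.smul_right, smul_eq_mul] <;> ring

/-- The double trace of the graded curvature tensor, computed in a basis adapted to `TM ⊕ ℝ` instead
of the frame in which it is defined. -/
theorem scalarCurvature_eq :
    scalarCurvature g θ x = SemiRiemannian.scalarCurvature g x - 2 *
      ∑ i, ∑ j, (gram (Algebroid.fiberForm g x)
        (Algebroid.frameBasis (F := E) (TangentSpace 𝓘(ℝ, E)) x))⁻¹ i j *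
        SemiRiemannian.hessianForm g θ
          (Algebroid.frameBasis (F := E) (TangentSpace 𝓘(ℝ, E)) x i)
          (Algebroid.frameBasis (F := E) (TangentSpace 𝓘(ℝ, E)) x j) := by
  set b := Algebroid.frameBasis (F := E) (TangentSpace 𝓘(ℝ, E)) x
  have h₁ : SemiRiemannian.scalarCurvature g x =
      ∑ i, ∑ j, (gram (Algebroid.fiberForm g x) b)⁻¹ i j *
        ∑ k, ∑ l, (gram (Algebroid.fiberForm g x) b)⁻¹ k l *
          SemiRiemannian.curvatureForm g (b i) (b k) (b l) (b j) :=
    Algebroid.scalar_eq_sum (F := E) (ρ := SemiRiemannian.anchor)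
      (br := VectorField.mlieBracket 𝓘(ℝ, E)) (g := g) (x := x)
  have h₂ : scalarCurvature g θ x = _ :=
    Algebroid.scalar_eq_sum (F := E × ℝ) (ρ := anchor) (br := bracket) (g := metric g θ) (x := x)
  simp only [inner_curvature_localExtension] at h₂
  rw [h₁, h₂, sum_inv_gram_mul_sum_eq (G := Algebroid.fiberForm (metric g θ) x)
    ((metric g θ).symm x) ((metric g θ).nondegenerate x) _ (b.prod (Basis.singleton Unit ℝ))
    isBilinearMap_gradedCurvatureForm_outer isBilinearMap_gradedCurvatureForm_inner,
    inv_gram_prod]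
  have hR (v w : TangentSpace 𝓘(ℝ, E) x) : SemiRiemannian.curvatureForm g 0 v w 0 = 0 := by
    simp [SemiRiemannian.curvatureForm]
  have hR' (u z : TangentSpace 𝓘(ℝ, E) x) : SemiRiemannian.curvatureForm g u 0 0 z = 0 := by
    simpa using (SemiRiemannian.isBilinearMap_curvatureForm_inner (g := g) u z).smul_left 0 0 0
  -- The Ricci curvature in tangent directions is the one of `g` minus the tensor
  -- `Hes(θ) + dθ ⊗ dθ`, the component along `ξ` contributes the trace of this tensor once more.
  simp only [Fintype.sum_sum_type, Matrix.fromBlocks_apply₁₁, Matrix.fromBlocks_apply₁₂,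
    Matrix.fromBlocks_apply₂₁, Matrix.fromBlocks_apply₂₂, Basis.prod_apply_inl_fst,
    Basis.prod_apply_inl_snd, Basis.prod_apply_inr_fst, Basis.prod_apply_inr_snd,
    Basis.singleton_apply, gradedCurvatureForm, hR, hR', Matrix.zero_apply, Matrix.of_apply,
    Finset.univ_unique, Finset.sum_singleton, zero_mul, mul_zero, zero_sub, sub_zero, one_mul,
    add_zero, zero_add, Finset.sum_const_zero, mul_neg, sub_self]
  have hexp (t : ℝ) : (Real.exp (2 * θ x))⁻¹ * (Real.exp (2 * θ x) * t) = t :=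
    inv_mul_cancel_left₀ (Real.exp_ne_zero _) t
  simp only [mul_add, mul_neg, hexp, Finset.sum_add_distrib, Finset.sum_neg_distrib,
    Finset.mul_sum]
  simp only [mul_left_comm _ (Real.exp (2 * θ x)), ← Finset.mul_sum]
  simp only [Finset.sum_const_zero, mul_zero, neg_zero, add_zero]
  field_simp [Real.exp_ne_zero]
  ring

/-- The tensor `T̃` is `Hes(θ) + dθ ⊗ dθ`. -/
theorem tensorT_localExtension (u v : TangentSpace 𝓘(ℝ, E) x) :
    tensorT g θ (Algebroid.localExtension E u) (Algebroid.localExtension E v) x =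
      SemiRiemannian.hessianForm g θ u v := by
  have hσ (u : TangentSpace 𝓘(ℝ, E) x) : CMDiffAt ∞ (T% (Algebroid.localExtension E u)) x :=
    Algebroid.contMDiffAt_localExtension u
  have hα : ∀ᶠ y in 𝓝 x, alpha g θ (Algebroid.localExtension E v) y =
      SemiRiemannian.differential θ (Algebroid.localExtension E v) y :=
    (SemiRiemannian.eventually_mdifferentiableAt (hσ v)).mono fun y hy ↦ alpha_eq hy
  have hd : SemiRiemannian.differential (alpha g θ (Algebroid.localExtension E v))
      (Algebroid.localExtension E u) x = SemiRiemannian.differential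
        (SemiRiemannian.differential θ (Algebroid.localExtension E v))
        (Algebroid.localExtension E u) x :=
    Algebroid.deriv_congr (ρ := SemiRiemannian.anchor)
      (X := Algebroid.localExtension E u) (X' := Algebroid.localExtension E u) rfl hα
  rw [tensorT, SemiRiemannian.covDerivForm, hd, hα.self_of_nhds,
    alpha_eq ((SemiRiemannian.contMDiffAt_leviCivita (hσ u) (hσ v)).mdifferentiableAt (by simp)),
    alpha_eq ((hσ u).mdifferentiableAt (by simp)), SemiRiemannian.hessianForm,
    SemiRiemannian.hessian, SemiRiemannian.covDerivForm]
  simp only [SemiRiemannian.differential, Algebroid.localExtension_self]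
  rfl

end

end Graded

end

theorem mainTheorem4 {E : Type*} [NormedAddCommGroup E] [NormedSpace ℝ E] [FiniteDimensional ℝ E]
    {M : Type*} [TopologicalSpace M] [ChartedSpace E M] [IsManifold 𝓘(ℝ, E) ∞ M]
    (g : SemiRiemannianMetric (E := E) E (TangentSpace 𝓘(ℝ, E) : M → Type _))
    (θ : C^∞⟮𝓘(ℝ, E), M; ℝ⟯) (x : M) :
    Graded.scalarCurvature g θ x =
        SemiRiemannian.scalarCurvature g x - 2 * Algebroid.trace g (Graded.tensorT g θ) x ∧
      Graded.scalarCurvature g θ x =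
        SemiRiemannian.scalarCurvature g x
          - 2 * (SemiRiemannian.laplacian g θ x + SemiRiemannian.gradientNormSq g θ x) := by
  rw [Graded.scalarCurvature_eq, Algebroid.trace_eq_sum, SemiRiemannian.laplacian,
    Algebroid.trace_eq_sum, ← SemiRiemannian.sum_inv_gram_mul_mfderiv_mul_mfderiv
      (Algebroid.frameBasis (F := E) (TangentSpace 𝓘(ℝ, E)) x)]
  simp only [Graded.tensorT_localExtension, SemiRiemannian.hessianForm, mul_add,
    Finset.sum_add_distrib, and_self]
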